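/- **Conventions.** Let $\mathbb{H}^2=\{p\in\mathbb{R}^3: -p_1^2+p_2^2+p_3^2=-1,\ p_1>0\}$, and embed $\mathbb{H}^2\times\mathbb{R}$ into $\mathbb{H}^2\times\mathbb{H}^2$ by $(p,s)\mapsto(p,(\cosh s,0,\sinh s))$. Let $\mathbb{R}^4_2$ be $\mathbb{R}^4$ with $\langle u,v\rangle=u_1v_1+u_2v_2-u_3v_3-u_4v_4$ and $\mathbf{H}^3_1=\{p\in\mathbb{R}^4_2:\langle p,p\rangle=-1\}$ (anti-de Sitter space). With $(e_j)$ the canonical basis, put in $\Lambda^2\mathbb{R}^4_2$ $$E_1^\pm=\tfrac1{\sqrt2}(e_1\wedge e_2\pm e_4\wedge e_3),\quad E_2^\pm=\tfrac1{\sqrt2}(e_1\wedge e_3\pm e_4\wedge e_2),\quad E_3^\pm=\tfrac1{\sqrt2}(e_1\wedge e_4\pm e_2\wedge e_3),$$ let $\Lambda^2_\pm=\mathrm{span}\{E^\pm_1,E^\pm_2,E^\pm_3\}$, and identify $(x,y)\in\mathbb{H}^2\times\mathbb{H}^2$ with $\bigl(\sum_j x_jE_j^+,\sum_j y_jE_j^-\bigr)\in\Lambda^2_+\times\Lambda^2_-$.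 Let $\Sigma$ be a Riemann surface and $\psi:\Sigma\to\mathbf{H}^3_1$ a conformal spacelike immersion that is maximal (zero mean curvature). Let $N_\psi$ be its timelike unit normal in $\mathbf{H}^3_1$ such that $(\psi_x,\psi_y,\psi,N_\psi)$ is positively oriented in $\mathbb{R}^4$ for conformal parameters $x+iy$. The Hopf differential of $\psi$ is $\Theta_\psi=\langle\psi_w,(N_\psi)_w\rangle\,dw\otimes dw$ ($w$ a conformal parameter), and the components of its Gauss map are $\nu_\psi^\pm=\frac1{\sqrt2}(\epsilon_1\wedge \epsilon_2\pm N_\psi\wedge\psi)$, where $(\epsilon_1,\epsilon_2)$ is an oriented orthonormal basis of the tangent plane of $\psi$. For $t\in\mathbb{R}$ the hyperbolic cylinder is $$\psi_t(x+iy)=\tfrac{1}{\sqrt2}(\sinh a_t,\sinh b_t,\cosh a_t,\cosh b_t),$$ $$a_t=(x+y)\cos\tfrac t2+(x-y)\sin\tfrac t2,\qquad b_t=(y-x)\cos\tfrac t2+(x+y)\sin\tfrac t2,$$ a conformal maximal immersion of $\mathbb{C}$ with Hopf differential $\frac i2e^{it}dz\otimes dz$. If $t\in\mathbb{R}$ and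 $z:\Sigma\to\mathbb{C}$ is a holomorphic function with nowhere vanishing differential such that $\Theta_\psi=\frac i2e^{it}\,dz\otimes dz$, the map $\hat\nu_\psi=(\nu^+_\psi,\ \nu^-_{\psi_t\circ z}):\Sigma\to\Lambda^2_+\times\Lambda^2_-$ is called a modified Gauss map of $\psi$ (it depends on the choice of $t$ and $z$). **Theorem.** Let $\Sigma$ be a simply connected Riemann surface with a Riemannian metric in its conformal class, and let $\phi:\Sigma\to\mathbb{H}^2\times\mathbb{R}$ be a smooth isometric minimal immersion whose angle function $\nu=\langle N,\partial_t\rangle$ ($N$ a unit normal of $\phi$, $\partial_t$ the unit vertical field) satisfies $\nu^2<1$ everywhere. Then there exist a conformal maximal immersion $\psi:\Sigma\to\mathbf{H}^3_1$, with a modified Gauss map $\hat\nu_\psi$ (for some $t$ and $z$ as above), and an isometry $F$ of $\mathbb{H}^2\times\mathbb{R}$ such that, under the embedding and identification above, $F\circ\phi=\hat\nu_\psi$ on $\Sigma$. -/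

import Mathlib

open scoped ContDiff Manifold

noncomputable section

/-! ### Surfaces in pseudo-Euclidean spaces

A Riemann surface `S` is a space with holomorphic charts in `ℂ`; its underlying real surface has
the model `𝓘(ℝ, ℂ)`.  The tangent space at `p` is `ℂ`, through the holomorphic chart `chartAt ℂ p`;
so multiplication by `Complex.I` is the complex structure, and `(1, Complex.I)` is `(∂x, ∂y)` for
the conformal parameter `z = x + iy` given by that chart. -/

namespace AdSGauss

/-- The space containing the hyperboloid model of the hyperbolic plane. -/
abbrev R31 := Fin 3 → ℝ

/-- The space `ℝ⁴₂` containing anti-de Sitter space. -/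
abbrev R42 := Fin 4 → ℝ

section Surface

variable {S : Type*} [TopologicalSpace S] [ChartedSpace ℂ S]
variable {E : Type*} [NormedAddCommGroup E] [NormedSpace ℝ E]

/-- The differential `dφ_p : T_p S → E`. -/
def diffAt (φ : S → E) (p : S) : ℂ →L[ℝ] E :=
  mfderiv 𝓘(ℝ, ℂ) 𝓘(ℝ, E) φ p

/-- The second derivative at `p` of `φ` read in the chart at `p`. -/
def secondDiffAt (φ : S → E) (p : S) (v w : ℂ) : E :=
  fderiv ℝ (fderiv ℝ (φ ∘ (chartAt ℂ p).symm)) (chartAt ℂ p p) v w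

/-- A field of bilinear forms on the tangent spaces of `S` is a Riemannian metric in the conformal
class of `S` if at each point it is a positive multiple of the Euclidean product of `ℂ`.  (Its
smoothness follows whenever it is induced by a smooth map.) -/
def IsConformalMetric
    (g : ∀ p : S, TangentSpace 𝓘(ℝ, ℂ) p → TangentSpace 𝓘(ℝ, ℂ) p → ℝ) : Prop :=
  ∀ p : S, ∃ c : ℝ, 0 < c ∧ ∀ v w : ℂ, g p v w = c * (v * starRingEnd ℂ w).re

/-- `φ` is smooth and the metric `g` is induced by `φ` from the bilinear form `B`. -/
def IsIsometricImmersion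
    (g : ∀ p : S, TangentSpace 𝓘(ℝ, ℂ) p → TangentSpace 𝓘(ℝ, ℂ) p → ℝ)
    (B : E → E → ℝ) (φ : S → E) : Prop :=
  ContMDiff 𝓘(ℝ, ℂ) 𝓘(ℝ, E) ∞ φ ∧
    ∀ (p : S) (v w : ℂ), B (diffAt φ p v) (diffAt φ p w) = g p v w

/-- A conformal spacelike immersion: the induced metric is a Riemannian metric in the conformal
class of `S`. -/
def IsConformalImmersion (B : E → E → ℝ) (φ : S → E) : Prop :=
  ∃ g : ∀ p : S, TangentSpace 𝓘(ℝ, ℂ) p → TangentSpace 𝓘(ℝ, ℂ) p → ℝ,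
    IsConformalMetric g ∧ IsIsometricImmersion g B φ

/-- Zero mean curvature of a spacelike immersion `φ` into a submanifold `M` of `(E, B)`, where
`T q` is the tangent space of `M` at `q`.  For a vector `ξ` tangent to `M` and normal to the
surface, `B (secondDiffAt φ p v w) ξ` is the `ξ`-component of the second fundamental form of the
surface in `M`; the condition is that its trace over orthonormal tangent bases vanishes. -/
def HasZeroMeanCurvature (B : E → E → ℝ) (T : E → Set E) (φ : S → E) : Prop :=
  ∀ p : S, ∀ ξ ∈ T (φ p), (∀ v : ℂ, B ξ (diffAt φ p v) = 0) →
    ∀ e₁ e₂ : ℂ, B (diffAt φ p e₁) (diffAt φ p e₁) = 1 → B (diffAt φ p e₂) (diffAt φ p e₂) = 1 →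
      B (diffAt φ p e₁) (diffAt φ p e₂) = 0 →
        B (secondDiffAt φ p e₁ e₁) ξ + B (secondDiffAt φ p e₂ e₂) ξ = 0

end Surface

/-! ### The space `ℍ² × ℝ` -/

/-- The Lorentzian product of `ℝ³`. -/
def lorentz (x y : R31) : ℝ := -(x 0 * y 0) + x 1 * y 1 + x 2 * y 2

/-- The hyperboloid model of the hyperbolic plane. -/
def H2 : Set R31 := {p | lorentz p p = -1 ∧ 0 < p 0}

/-- `ℍ² × ℝ`, inside `ℝ³ × ℝ`. -/
def H2R : Set (R31 × ℝ) := {q | q.1 ∈ H2}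

/-- The product form on `ℝ³ × ℝ`, which induces the product metric of `ℍ² × ℝ`. -/
def formH2R (x y : R31 × ℝ) : ℝ := lorentz x.1 y.1 + x.2 * y.2

/-- The tangent space of `ℍ² × ℝ` at `q`. -/
def tangentH2R (q : R31 × ℝ) : Set (R31 × ℝ) := {v | lorentz q.1 v.1 = 0}

/-- The vertical field `∂_t` of `ℍ² × ℝ`. -/
def vertical : R31 × ℝ := (0, 1)

/-- Isometries of the Riemannian manifold `ℍ² × ℝ`, given by a smooth extension to `ℝ³ × ℝ`. -/
def IsIsometryH2R (F : R31 × ℝ → R31 × ℝ) : Prop :=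
  ContDiff ℝ ∞ F ∧ Set.BijOn F H2R H2R ∧
    ∀ q ∈ H2R, ∀ v ∈ tangentH2R q, ∀ w ∈ tangentH2R q,
      formH2R (fderiv ℝ F q v) (fderiv ℝ F q w) = formH2R v w

/-- The totally geodesic embedding of `ℍ² × ℝ` into `ℍ² × ℍ²`. -/
def embH2R (q : R31 × ℝ) : R31 × R31 := (q.1, ![Real.cosh q.2, 0, Real.sinh q.2])

/-! ### Anti-de Sitter space and bivectors -/

/-- The form of index two on `ℝ⁴₂`. -/
def form42 (u v : R42) : ℝ := u 0 * v 0 + u 1 * v 1 - u 2 * v 2 - u 3 * v 3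

/-- Anti-de Sitter space. -/
def AdS : Set R42 := {p | form42 p p = -1}

/-- The tangent space of anti-de Sitter space at `q`. -/
def tangentAdS (q : R42) : Set R42 := {v | form42 q v = 0}

/-- Bivectors of `ℝ⁴₂`. -/
abbrev Biv := ⋀[ℝ]^2 R42

/-- The bivector `v ∧ w`. -/
def wedge (v w : R42) : Biv := exteriorPower.ιMulti ℝ 2 ![v, w]

/-- The canonical basis of `ℝ⁴₂`, numbered from `0`. -/
def e (i : Fin 4) : R42 := Pi.single i 1

/-- The frame `E₁, E₂, E₃` of the eigenspace `Λ²₊` (for `s = 1`) or `Λ²₋` (for `s = -1`) of the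
star operator of `Λ² ℝ⁴₂`. -/
def frame (s : ℝ) : Fin 3 → Biv :=
  ![(1 / √2) • (wedge (e 0) (e 1) + s • wedge (e 3) (e 2)),
    (1 / √2) • (wedge (e 0) (e 2) + s • wedge (e 3) (e 1)),
    (1 / √2) • (wedge (e 0) (e 3) + s • wedge (e 1) (e 2))]

/-- The linear isometry `ℝ³ → Λ²_s` with `x ↦ x₁ E₁ + x₂ E₂ + x₃ E₃`; it takes the hyperbolic
plane `ℍ²` onto `ℍ²_s`. -/
def toBiv (s : ℝ) (x : R31) : Biv := ∑ j, x j • frame s j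

/-- The identification of `ℍ² × ℍ²` with `ℍ²₊ × ℍ²₋`. -/
def pairToBiv (x : R31 × R31) : Biv × Biv := (toBiv 1 x.1, toBiv (-1) x.2)

section Gauss

variable {S : Type*} [TopologicalSpace S] [ChartedSpace ℂ S]

/-- A conformal (spacelike) maximal immersion into anti-de Sitter space. -/
structure IsConformalMaximalImmersion (ψ : S → R42) : Prop where
  mem : ∀ p, ψ p ∈ AdS
  conformal : IsConformalImmersion form42 ψ
  maximal : HasZeroMeanCurvature form42 tangentAdS ψ

/-- `N` is the unit timelike normal field in anti-de Sitter space of the immersion `ψ` such that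
`(ψ_x, ψ_y, ψ, N)` is positively oriented in `ℝ⁴`. -/
structure IsOrientedNormal (ψ N : S → R42) : Prop where
  smooth : ContMDiff 𝓘(ℝ, ℂ) 𝓘(ℝ, R42) ∞ N
  unit : ∀ p, form42 (N p) (N p) = -1
  tangent : ∀ p, N p ∈ tangentAdS (ψ p)
  normal : ∀ p (v : ℂ), form42 (N p) (diffAt ψ p v) = 0
  oriented : ∀ p, 0 <
    (Matrix.of ![diffAt ψ p 1, diffAt ψ p Complex.I, ψ p, N p]).det

/-- The coefficient `θ = ⟨ψ_z, N_z⟩` of the Hopf differential `θ dz ⊗ dz` of `ψ` at `p`, in the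
chart at `p`; here `∂_z = (∂_x - i ∂_y) / 2`. -/
def hopf (ψ N : S → R42) (p : S) : ℂ :=
  (1 / 4 : ℂ) *
    ((form42 (diffAt ψ p 1) (diffAt N p 1)
        - form42 (diffAt ψ p Complex.I) (diffAt N p Complex.I) : ℝ)
      - Complex.I * (form42 (diffAt ψ p 1) (diffAt N p Complex.I)
        + form42 (diffAt ψ p Complex.I) (diffAt N p 1) : ℝ))

/-- The component `ν^s = (e₁ ∧ e₂ + s N ∧ ψ) / √2` of the Gauss map of a conformal immersion `ψ`
with oriented normal `N`.  As `ψ` is conformal, `ψ_x ∧ ψ_y / ⟨ψ_x, ψ_x⟩` is `e₁ ∧ e₂` for any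
oriented orthonormal basis `(e₁, e₂)` of the tangent plane. -/
def gaussMap (s : ℝ) (ψ N : S → R42) (p : S) : Biv :=
  (1 / √2) • ((form42 (diffAt ψ p 1) (diffAt ψ p 1))⁻¹ •
      wedge (diffAt ψ p 1) (diffAt ψ p Complex.I) + s • wedge (N p) (ψ p))

/-- The hyperbolic cylinder `ψ_t`, as a map on `ℂ`. -/
def cylinder (t : ℝ) (z : ℂ) : R42 :=
  let a := (z.re + z.im) * Real.cos (t / 2) + (z.re - z.im) * Real.sin (t / 2)
  let b := (z.im - z.re) * Real.cos (t / 2) + (z.re + z.im) * Real.sin (t / 2)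
  (1 / √2) • ![Real.sinh a, Real.sinh b, Real.cosh a, Real.cosh b]

/-- The complex differential `df_p : T_p S → ℂ`. -/
def complexDiffAt (f : S → ℂ) (p : S) : ℂ →L[ℂ] ℂ :=
  mfderiv 𝓘(ℂ) 𝓘(ℂ) f p

/-- `G` is the modified Gauss map `(ν⁺_ψ, ν⁻_{ψ_t})` of `ψ`: here `z : S → ℂ` is holomorphic with
nowhere vanishing differential (so it is a conformal parameter near each point), the Hopf
differential of `ψ` is `(i/2) e^{it} dz ⊗ dz`, and the hyperbolic cylinder is read on `S` through
`z`, so that it has the same Hopf differential. -/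
def IsModifiedGaussMap (ψ : S → R42) (G : S → Biv × Biv) : Prop :=
  ∃ (N : S → R42) (t : ℝ) (z : S → ℂ) (N' : S → R42),
    IsOrientedNormal ψ N ∧
    MDifferentiable 𝓘(ℂ) 𝓘(ℂ) z ∧ (∀ p, complexDiffAt z p 1 ≠ 0) ∧
    (∀ p, hopf ψ N p =
      Complex.I / 2 * Complex.exp (Complex.I * t) * complexDiffAt z p 1 ^ 2) ∧
    IsOrientedNormal (fun p => cylinder t (z p)) N' ∧
    ∀ p, G p = (gaussMap 1 ψ N p, gaussMap (-1) (fun p => cylinder t (z p)) N' p)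

/-- `N` is a field of unit normal vectors in `ℍ² × ℝ` of the immersion `φ`. -/
structure IsUnitNormalH2R (φ N : S → R31 × ℝ) : Prop where
  unit : ∀ p, formH2R (N p) (N p) = 1
  tangent : ∀ p, N p ∈ tangentH2R (φ p)
  normal : ∀ p (v : ℂ), formH2R (N p) (diffAt φ p v) = 0

/-- The angle function `⟨N, ∂_t⟩`. -/
def angle (N : S → R31 × ℝ) (p : S) : ℝ := formH2R (N p) vertical

end Gauss

end AdSGauss

end

/-!
# Minimal surfaces in `ℍ² × ℝ` are modified Gauss maps

Write `φ = (η, h)`.  As `φ` is conformal and minimal, `η` is a harmonic map into `ℍ²` and `h` is a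
harmonic function; conformality says that the Hopf differential of `η` is `-(∂h)²`, and the bound
on the angle function says that `dh` vanishes nowhere (`isMinimalPair_of_minimal`).

*The immersion `ψ`.*  A vector `x` of the Lorentzian `ℝ³` acts on `ℝ⁴₂` as the skew endomorphism
`clifford x` given by the corresponding bivector of `Λ²₊`.  If `ψ` is an immersion with normal `N`
whose Gauss map has the component `ν⁺ = η`, then `N = η · ψ`, the tangent plane is `η^⊥ · ψ`, and
`dψ = ω · ψ` for a one-form `ω` with values in `η^⊥ = T_η ℍ²`.  The form
`ω = (η × dη + dη ∘ i) / 2` (`gaussForm`) is, up to a rotation by a right angle, the complex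
linear part `∂η` of `dη`.  The equation `dψ = ω · ψ` is integrable exactly because `η` is harmonic
(`isFlatAt_planeConnection`), so on a simply connected surface it has a solution in anti-de Sitter
space (`IsFlatConnection.exists_global`).  The induced metric is `⟨ω, ω⟩`, which is conformal; it
is positive since `∂η` vanishes only where the Hopf differential of `η` does, that is nowhere
(`gaussForm_pos`).  The trace of the second fundamental form of `ψ` involves `η` only through
`η × Δη = 0`, so that `ψ` is maximal, and its Hopf differential is `-(i/8) (h_x - i h_y)² dw²`
(`IsParallelSection.hopf_eq`).

*The parameter `z`.*  Let `z` be a holomorphic function with imaginary part `h / 2`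
(`IsMinimalPair.exists_holomorphic`).  Then `(i/2) dz²` is the Hopf differential of `ψ`, and the
component `ν⁻` of the Gauss map of the cylinder `ψ₀` at `z` is `(cosh h, 0, sinh h)`
(`gaussMap_cylinder`), the image of the height `h` under the embedding of `ℍ² × ℝ`.  So
`φ = (η, h)` is itself a modified Gauss map of `ψ`, and the isometry `F` is the identity.

Both integrations, of `ω` and of the conjugate differential of `h`, are cases of one statement on
flat connection forms with values in a Banach algebra.  Local parallel frames are obtained by
solving an ordinary differential equation along rays (`exists_local_parallel_frame`); they differ
by locally constant factors, and are glued by lifting the identity to a covering of the surface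
(`exists_global_of_locally_constant_transition`).
-/

/-! ### Local parallel frames of a flat connection form -/

section LocalFrame

open Set Filter Metric Topology

variable {𝔸 : Type*} [NormedRing 𝔸] [NormedAlgebra ℝ 𝔸]
variable {E : Type*} [NormedAddCommGroup E] [NormedSpace ℝ E]

/-- The linear differential equation `u' = B u` on `[0, 1]` with `u 0 = 1`, for a coefficient of
norm at most `1 / 2`. -/
theorem exists_linear_ode_solution [CompleteSpace 𝔸] (B : ℝ → 𝔸) (hB : ContinuousOn B (Icc 0 1))
    (hB' : ∀ t ∈ Icc (0 : ℝ) 1, ‖B t‖ ≤ 1 / 2) :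
    ∃ u : ℝ → 𝔸, u 0 = 1 ∧ ∀ t ∈ Icc (0 : ℝ) 1, HasDerivWithinAt u (B t * u t) (Icc 0 1) t := by
  have hP : IsPicardLindelof (fun t x => B t * x) (tmin := 0) (tmax := 1) ⟨0, by simp⟩ (1 : 𝔸)
      ‖(1 : 𝔸)‖₊ 0 ‖(1 : 𝔸)‖₊ (1 / 2) := by
    refine ⟨fun t ht => ?_, fun x _ => hB.mul continuousOn_const, fun t ht x hx => ?_, by simp⟩
    · refine LipschitzOnWith.of_dist_le_mul fun x _ y _ => ?_
      rw [dist_eq_norm, dist_eq_norm, ← mul_sub]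
      refine (norm_mul_le _ _).trans (mul_le_mul_of_nonneg_right ?_ (norm_nonneg _))
      simpa using hB' t ht
    · have hx' : ‖x‖ ≤ 2 * ‖(1 : 𝔸)‖ := by
        have h1 : ‖x - 1‖ ≤ ‖(1 : 𝔸)‖ := by simpa [dist_eq_norm] using hx
        have h2 := norm_add_le (x - 1) (1 : 𝔸)
        rw [sub_add_cancel] at h2
        linarith
      refine (norm_mul_le _ _).trans ?_
      have := mul_le_mul (hB' t ht) hx' (norm_nonneg _) (by norm_num)
      simp only [coe_nnnorm]
      linarith
  obtain ⟨u, hu0, hu⟩ := hP.exists_eq_forall_mem_Icc_hasDerivWithinAt₀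
  exact ⟨u, hu0, hu⟩

/-- The solutions of `u' = B u` along two nearby rays differ, to first order in the displacement
`h`, by `A h * u`.  Flatness of `A` makes the first-order terms in the derivative of the
difference cancel. -/
theorem norm_radial_variation_le {A : E → E →L[ℝ] 𝔸} {x p h : E} {C K₁ K₂ M : ℝ}
    (hC : 0 < C) {u u₁ : ℝ → 𝔸}
    (hA : ∀ t ∈ Icc (0 : ℝ) 1, DifferentiableAt ℝ A (x + t • p))
    (hflat : ∀ t ∈ Icc (0 : ℝ) 1, ∀ v w, fderiv ℝ A (x + t • p) v w
      + A (x + t • p) w * A (x + t • p) v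
        = fderiv ℝ A (x + t • p) w v + A (x + t • p) v * A (x + t • p) w)
    (hAC : ∀ t ∈ Icc (0 : ℝ) 1, ‖A (x + t • p)‖ ≤ C)
    (hB₁ : ∀ t ∈ Icc (0 : ℝ) 1, ‖A (x + t • (p + h)) (p + h)‖ ≤ 1 / 2)
    (hK₁ : ∀ t ∈ Icc (0 : ℝ) 1, ‖A (x + t • (p + h)) - A (x + t • p)‖ ≤ K₁ * ‖h‖)
    (hK₂ : ∀ t ∈ Icc (0 : ℝ) 1, ‖A (x + t • (p + h)) - A (x + t • p)
      - fderiv ℝ A (x + t • p) (t • h)‖ ≤ K₂ * ‖h‖ ^ 2)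
    (hu : ∀ t ∈ Icc (0 : ℝ) 1, HasDerivWithinAt u (A (x + t • p) p * u t) (Icc 0 1) t)
    (hu₁ : ∀ t ∈ Icc (0 : ℝ) 1,
      HasDerivWithinAt u₁ (A (x + t • (p + h)) (p + h) * u₁ t) (Icc 0 1) t)
    (hu0 : u 0 = u₁ 0) (huM : ∀ t ∈ Icc (0 : ℝ) 1, ‖u t‖ ≤ M) :
    ‖u₁ 1 - u 1 - A (x + p) h * u 1‖ ≤
      gronwallBound 0 (1 / 2) (((K₂ * ‖p‖ + K₁) * M + (K₁ * ‖p + h‖ + C) * C * M) * ‖h‖ ^ 2) 1 := by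
  set δ : ℝ → 𝔸 := fun t => u₁ t - u t - A (x + t • p) (t • h) * u t with hδ
  set δ' : ℝ → 𝔸 := fun t => A (x + t • (p + h)) (p + h) * u₁ t - A (x + t • p) p * u t
    - ((fderiv ℝ A (x + t • p) p (t • h) + A (x + t • p) h) * u t
      + A (x + t • p) (t • h) * (A (x + t • p) p * u t)) with hδ'
  have hder : ∀ t ∈ Icc (0 : ℝ) 1, HasDerivWithinAt δ (δ' t) (Icc 0 1) t := by
    intro t ht
    refine ((hu₁ t ht).sub (hu t ht)).sub (HasDerivWithinAt.mul ?_ (hu t ht))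
    have h1 : HasDerivAt (fun t : ℝ => x + t • p) p t := by
      simpa using ((hasDerivAt_id t).smul_const p).const_add x
    have h2 : HasDerivAt (fun t : ℝ => A (x + t • p)) (fderiv ℝ A (x + t • p) p) t :=
      (hA t ht).hasFDerivAt.comp_hasDerivAt t h1
    have h3 : HasDerivAt (fun t : ℝ => t • h) h t := by
      simpa using (hasDerivAt_id t).smul_const h
    exact (h2.clm_apply h3).hasDerivWithinAt
  have hbound : ∀ t ∈ Ico (0 : ℝ) 1, ‖δ' t‖ ≤ 1 / 2 * ‖δ t‖ +
      ((K₂ * ‖p‖ + K₁) * M + (K₁ * ‖p + h‖ + C) * C * M) * ‖h‖ ^ 2 := by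
    intro t ht'
    have ht : t ∈ Icc (0 : ℝ) 1 := ⟨ht'.1, ht'.2.le⟩
    set a := A (x + t • p)
    set a₁ := A (x + t • (p + h))
    set d := fderiv ℝ A (x + t • p)
    -- by flatness, only terms of second order in `h` remain besides `A (p + h) * δ`
    have hsplit : δ' t = a₁ (p + h) * δ t
        + (((a₁ - a - d (t • h)) p + (a₁ - a) h) * u t
        + ((a₁ - a) (p + h) + a h) * a (t • h) * u t) := by
      have hf := hflat t ht p (t • h)
      have hf' : d p (t • h) = d (t • h) p + a p * a (t • h) - a (t • h) * a p := by
        rw [eq_sub_iff_add_eq]; exact hf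
      simp only [hδ, hδ']
      change a₁ (p + h) * u₁ t - a p * u t
        - ((d p (t • h) + a h) * u t + a (t • h) * (a p * u t))
        = a₁ (p + h) * (u₁ t - u t - a (t • h) * u t) + _
      rw [hf']
      simp only [sub_apply, map_add]
      noncomm_ring
    have ht1 : ‖t • h‖ ≤ ‖h‖ := by
      rw [norm_smul, Real.norm_of_nonneg ht.1]
      exact mul_le_of_le_one_left (norm_nonneg _) ht.2
    have hK₁' : 0 ≤ K₁ * ‖h‖ := (norm_nonneg _).trans (hK₁ t ht)
    have hK₂' : 0 ≤ K₂ * ‖h‖ ^ 2 := (norm_nonneg _).trans (hK₂ t ht)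
    have e1 : ‖(a₁ - a - d (t • h)) p‖ ≤ K₂ * ‖h‖ ^ 2 * ‖p‖ :=
      ContinuousLinearMap.le_of_opNorm_le _ (hK₂ t ht) p
    have e2 : ‖(a₁ - a) h‖ ≤ K₁ * ‖h‖ * ‖h‖ := ContinuousLinearMap.le_of_opNorm_le _ (hK₁ t ht) h
    have e3 : ‖(a₁ - a) (p + h)‖ ≤ K₁ * ‖h‖ * ‖p + h‖ :=
      ContinuousLinearMap.le_of_opNorm_le _ (hK₁ t ht) _
    have e4 : ‖a h‖ ≤ C * ‖h‖ := ContinuousLinearMap.le_of_opNorm_le _ (hAC t ht) _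
    have e5 : ‖a (t • h)‖ ≤ C * ‖h‖ := (ContinuousLinearMap.le_of_opNorm_le _ (hAC t ht) _).trans
      (mul_le_mul_of_nonneg_left ht1 hC.le)
    have s1 : ‖a₁ (p + h) * δ t‖ ≤ 1 / 2 * ‖δ t‖ := (norm_mul_le _ _).trans
      (mul_le_mul_of_nonneg_right (hB₁ t ht) (norm_nonneg _))
    have s2 : ‖((a₁ - a - d (t • h)) p + (a₁ - a) h) * u t‖
        ≤ (K₂ * ‖h‖ ^ 2 * ‖p‖ + K₁ * ‖h‖ * ‖h‖) * M := by
      refine (norm_mul_le _ _).trans (mul_le_mul ((norm_add_le _ _).trans (add_le_add e1 e2))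
        (huM t ht) (norm_nonneg _) ?_)
      positivity
    have s3 : ‖((a₁ - a) (p + h) + a h) * a (t • h) * u t‖
        ≤ (K₁ * ‖h‖ * ‖p + h‖ + C * ‖h‖) * (C * ‖h‖) * M := by
      refine (norm_mul_le _ _).trans (mul_le_mul ((norm_mul_le _ _).trans
        (mul_le_mul ((norm_add_le _ _).trans (add_le_add e3 e4)) e5 (norm_nonneg _) ?_))
        (huM t ht) (norm_nonneg _) ?_) <;> positivity
    rw [hsplit]
    refine (norm_add_le _ _).trans (add_le_add s1 ((norm_add_le _ _).trans
      ((add_le_add s2 s3).trans (le_of_eq ?_))))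
    ring
  have hcont : ContinuousOn δ (Icc 0 1) := fun t ht => (hder t ht).continuousWithinAt
  have := norm_le_gronwallBound_of_norm_deriv_right_le (δ := 0) hcont
    (fun t ht => (hder t ⟨ht.1, ht.2.le⟩).mono_of_mem_nhdsWithin (Icc_mem_nhdsGE_of_mem ht))
    (by simp [hδ, hu0]) hbound 1 (by simp)
  simpa [hδ] using this

/-- A flat connection form `A` has a parallel frame near each point: a solution of `dY = A Y` with
`Y = 1` there.  The frame is found along rays, and `norm_radial_variation_le` differentiates it in
the transverse directions. -/
theorem exists_local_parallel_frame [CompleteSpace 𝔸] {A : E → E →L[ℝ] 𝔸} {x : E}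
    (hA : ContDiffAt ℝ 2 A x)
    (hflat : ∀ᶠ u in 𝓝 x, ∀ v w, fderiv ℝ A u v w + A u w * A u v
      = fderiv ℝ A u w v + A u v * A u w) :
    ∃ Y : E → 𝔸, Y x = 1 ∧
      ∀ᶠ u in 𝓝 x, HasFDerivAt Y ((ContinuousLinearMap.mul ℝ 𝔸).flip (Y u) ∘L A u) u := by
  obtain ⟨K₁, s₁, hs₁, hK₁⟩ :=
    (hA.of_le (by norm_num : (1 : WithTop ℕ∞) ≤ 2)).exists_lipschitzOnWith
  obtain ⟨K₂, s₂, hs₂, hK₂⟩ :=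
    (hA.fderiv_right (m := 1) (by norm_num)).exists_lipschitzOnWith
  have hdiff : ∀ᶠ u in 𝓝 x, DifferentiableAt ℝ A u :=
    (hA.eventually (by simp)).mono fun u hu => hu.differentiableAt (by simp)
  set C : ℝ := ‖A x‖ + 1 with hCdef
  have hC : 0 < C := by positivity
  have hbdd : ∀ᶠ u in 𝓝 x, ‖A u‖ ≤ C :=
    (hA.continuousAt.norm.eventually (gt_mem_nhds (lt_add_one ‖A x‖))).mono fun u hu => hu.le
  obtain ⟨r₀, hr₀, hball⟩ := Metric.eventually_nhds_iff_ball.1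
    ((hdiff.and hbdd).and (hflat.and ((eventually_mem_set.2 hs₁).and (eventually_mem_set.2 hs₂))))
  -- on this ball the radial equation has a coefficient of norm at most `1 / 2`
  set r := min r₀ (1 / (2 * C)) with hrdef
  have hr : 0 < r := lt_min hr₀ (by positivity)
  have hmem : ∀ q : E, ‖q‖ < r → ∀ t ∈ Icc (0 : ℝ) 1, x + t • q ∈ ball x r₀ := by
    intro q hq t ht
    rw [mem_ball, dist_eq_norm, add_sub_cancel_left, norm_smul, Real.norm_of_nonneg ht.1]
    exact (mul_le_of_le_one_left (norm_nonneg _) ht.2).trans_lt (hq.trans_le (min_le_left _ _))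
  have hhalf : ∀ q : E, ‖q‖ < r → ∀ t ∈ Icc (0 : ℝ) 1, ‖A (x + t • q) q‖ ≤ 1 / 2 := by
    intro q hq t ht
    refine (ContinuousLinearMap.le_of_opNorm_le _ (hball _ (hmem q hq t ht)).1.2 q).trans ?_
    calc C * ‖q‖ ≤ C * (1 / (2 * C)) :=
          mul_le_mul_of_nonneg_left (hq.le.trans (min_le_right _ _)) hC.le
      _ = 1 / 2 := by field_simp
  have hray : ∀ q : E, ‖q‖ < r → ContinuousOn (fun t : ℝ => A (x + t • q)) (Icc 0 1) := by
    intro q hq t ht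
    have h1 : ContinuousAt (fun t : ℝ => x + t • q) t := by fun_prop
    exact (ContinuousAt.comp (f := fun t : ℝ => x + t • q)
      (hball _ (hmem q hq t ht)).1.1.continuousAt h1).continuousWithinAt
  -- `U q` solves the equation along the segment from `x` to `x + q`; the frame is `U (u - x) 1`
  have hsol : ∀ q : E, ∃ u : ℝ → 𝔸, ‖q‖ < r → u 0 = 1 ∧
      ∀ t ∈ Icc (0 : ℝ) 1, HasDerivWithinAt u (A (x + t • q) q * u t) (Icc 0 1) t := by
    intro q
    by_cases hq : ‖q‖ < r
    · obtain ⟨u, hu⟩ := exists_linear_ode_solution (fun t => A (x + t • q) q)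
        ((hray q hq).clm_apply continuousOn_const) (hhalf q hq)
      exact ⟨u, fun _ => hu⟩
    · exact ⟨0, fun h => absurd h hq⟩
  choose U hU using hsol
  have hquad : ∀ p : E, ‖p‖ < r → ∃ K : ℝ, ∀ h : E, ‖p + h‖ < r →
      ‖U (p + h) 1 - U p 1 - A (x + p) h * U p 1‖ ≤ K * ‖h‖ ^ 2 := by
    intro p hp
    have hcont : ContinuousOn (U p) (Icc 0 1) := fun t ht => ((hU p hp).2 t ht).continuousWithinAt
    obtain ⟨M, hM⟩ := isCompact_Icc.exists_bound_of_continuousOn hcont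
    have hM0 : 0 ≤ M := (norm_nonneg _).trans (hM 0 (by simp))
    refine ⟨((K₂ * ‖p‖ + K₁) * M + (K₁ * r + C) * C * M) / (1 / 2) * (Real.exp (1 / 2 * 1) - 1),
      fun h hph => ?_⟩
    have hdist : ∀ t ∈ Icc (0 : ℝ) 1, ‖(x + t • (p + h)) - (x + t • p)‖ ≤ ‖h‖ := by
      intro t ht
      have : (x + t • (p + h)) - (x + t • p) = t • h := by simp [smul_add]
      rw [this, norm_smul, Real.norm_of_nonneg ht.1]
      exact mul_le_of_le_one_left (norm_nonneg _) ht.2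
    have hconv := convex_ball x r₀
    have key := norm_radial_variation_le (A := A) (x := x) (p := p) (h := h) (C := C) (K₁ := K₁)
      (K₂ := K₂) (M := M) hC (u := U p) (u₁ := U (p + h))
      (fun t ht => (hball _ (hmem p hp t ht)).1.1)
      (fun t ht => (hball _ (hmem p hp t ht)).2.1)
      (fun t ht => (hball _ (hmem p hp t ht)).1.2) (hhalf _ hph)
      (fun t ht => by
        have h1 := hK₁.dist_le_mul _ (hball _ (hmem _ hph t ht)).2.2.1 _
          (hball _ (hmem p hp t ht)).2.2.1
        rw [dist_eq_norm, dist_eq_norm] at h1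
        exact h1.trans (mul_le_mul_of_nonneg_left (hdist t ht) K₁.2))
      (fun t ht => by
        have h0 : t • h = (x + t • (p + h)) - (x + t • p) := by simp [smul_add]
        set b := x + t • (p + h) with hb
        set a := x + t • p with ha
        have hseg : segment ℝ a b ⊆ ball x r₀ :=
          hconv.segment_subset (hmem p hp t ht) (hmem _ hph t ht)
        have h1 := (convex_segment a b).norm_image_sub_le_of_norm_hasFDerivWithin_le'
          (f := A) (f' := fderiv ℝ A) (φ := fderiv ℝ A a) (C := K₂ * ‖h‖)
          (fun z hz => (hball z (hseg hz)).1.1.hasFDerivAt.hasFDerivWithinAt)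
          (fun z hz => by
            have h2 := hK₂.dist_le_mul _ (hball z (hseg hz)).2.2.2 _
              (hball a (hseg (left_mem_segment ℝ a b))).2.2.2
            rw [dist_eq_norm, dist_eq_norm] at h2
            refine h2.trans (mul_le_mul_of_nonneg_left ?_ K₂.2)
            have h3 := norm_sub_le_of_mem_segment hz
            exact h3.trans (hdist t ht))
          (left_mem_segment ℝ a b) (right_mem_segment ℝ a b)
        rw [h0]
        refine h1.trans ?_
        rw [sq, ← mul_assoc]
        exact mul_le_mul_of_nonneg_left (hdist t ht) (by positivity))
      (hU p hp).2 (hU _ hph).2 ((hU p hp).1.trans (hU _ hph).1.symm) hM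
    rw [gronwallBound_of_K_ne_0 (by norm_num)] at key
    simp only [zero_mul, zero_add] at key
    refine key.trans ?_
    have hexp : 0 ≤ Real.exp (1 / 2 * 1) - 1 := by
      have := Real.add_one_le_exp (1 / 2 * 1 : ℝ)
      linarith
    have hle : ((K₂ * ‖p‖ + K₁) * M + (K₁ * ‖p + h‖ + C) * C * M) * ‖h‖ ^ 2
        ≤ ((K₂ * ‖p‖ + K₁) * M + (K₁ * r + C) * C * M) * ‖h‖ ^ 2 := by
      have := hph.le
      gcongr
    calc _ ≤ ((K₂ * ‖p‖ + K₁) * M + (K₁ * r + C) * C * M) * ‖h‖ ^ 2 / (1 / 2)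
          * (Real.exp (1 / 2 * 1) - 1) :=
        mul_le_mul_of_nonneg_right (div_le_div_of_nonneg_right hle (by norm_num)) hexp
      _ = _ := by ring
  refine ⟨fun u => U (u - x) 1, ?_, ?_⟩
  · have h0 : ‖(0 : E)‖ < r := by simpa using hr
    have hconst := eq_zero_of_abs_deriv_le_mul_abs_self_of_eq_zero_right (K := 0)
      (f := fun t => U 0 t - 1) (f' := fun t => A (x + t • (0 : E)) 0 * U 0 t) (a := 0) (b := 1)
      (fun t ht => (((hU 0 h0).2 t ht).sub_const 1).continuousWithinAt)
      (fun t ht => (((hU 0 h0).2 t ⟨ht.1, ht.2.le⟩).sub_const 1).mono_of_mem_nhdsWithin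
        (Icc_mem_nhdsGE_of_mem ht))
      (by simp [(hU 0 h0).1]) (by simp) 1 (by simp)
    simpa [sub_eq_zero] using hconst
  · filter_upwards [ball_mem_nhds x hr] with u hu
    rw [mem_ball, dist_eq_norm] at hu
    obtain ⟨K, hK⟩ := hquad (u - x) hu
    rw [hasFDerivAt_iff_isLittleO_nhds_zero]
    refine Asymptotics.IsBigO.trans_isLittleO (g := fun h : E => ‖h‖ ^ 2) ?_
      (Asymptotics.isLittleO_norm_pow_id one_lt_two)
    refine Asymptotics.IsBigO.of_bound K ?_
    have hnear : ∀ᶠ h : E in 𝓝 0, ‖u - x + h‖ < r := by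
      have hc : ContinuousAt (fun h : E => ‖u - x + h‖) 0 := by fun_prop
      exact hc.eventually (gt_mem_nhds (by simpa using hu))
    filter_upwards [hnear] with h hh
    have := hK h hh
    rw [Real.norm_of_nonneg (by positivity)]
    simpa [add_sub_right_comm] using this

/-- Two solutions of the same total differential equation `dY = A Y` that agree at a point agree
near it. -/
theorem eventually_eq_of_parallel {A : E → E →L[ℝ] 𝔸} {x : E} (hA : ContinuousAt A x)
    {Y₁ Y₂ : E → 𝔸}
    (h₁ : ∀ᶠ u in 𝓝 x, HasFDerivAt Y₁ ((ContinuousLinearMap.mul ℝ 𝔸).flip (Y₁ u) ∘L A u) u)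
    (h₂ : ∀ᶠ u in 𝓝 x, HasFDerivAt Y₂ ((ContinuousLinearMap.mul ℝ 𝔸).flip (Y₂ u) ∘L A u) u)
    (h : Y₁ x = Y₂ x) : ∀ᶠ u in 𝓝 x, Y₁ u = Y₂ u := by
  have hbdd : ∀ᶠ u in 𝓝 x, ‖A u‖ ≤ ‖A x‖ + 1 :=
    (hA.norm.eventually (gt_mem_nhds (lt_add_one ‖A x‖))).mono fun u hu => hu.le
  obtain ⟨r, hr, hball⟩ := Metric.eventually_nhds_iff_ball.1 (hbdd.and (h₁.and h₂))
  filter_upwards [ball_mem_nhds x hr] with u hu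
  have hmem : ∀ t ∈ Icc (0 : ℝ) 1, x + t • (u - x) ∈ ball x r := by
    intro t ht
    rw [mem_ball, dist_eq_norm] at hu ⊢
    rw [add_sub_cancel_left, norm_smul, Real.norm_of_nonneg ht.1]
    exact (mul_le_of_le_one_left (norm_nonneg _) ht.2).trans_lt hu
  have hder : ∀ t ∈ Icc (0 : ℝ) 1,
      HasDerivAt (fun t : ℝ => Y₁ (x + t • (u - x)) - Y₂ (x + t • (u - x)))
        (A (x + t • (u - x)) (u - x) * (Y₁ (x + t • (u - x)) - Y₂ (x + t • (u - x)))) t := by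
    intro t ht
    have h1 : HasDerivAt (fun t : ℝ => x + t • (u - x)) (u - x) t := by
      simpa using ((hasDerivAt_id t).smul_const (u - x)).const_add x
    have := ((hball _ (hmem t ht)).2.1.comp_hasDerivAt t h1).sub
      ((hball _ (hmem t ht)).2.2.comp_hasDerivAt t h1)
    rw [mul_sub]
    exact this
  have := eq_zero_of_abs_deriv_le_mul_abs_self_of_eq_zero_right
    (K := (‖A x‖ + 1) * ‖u - x‖)
    (fun t ht => (hder t ht).continuousAt.continuousWithinAt)
    (fun t ht => (hder t ⟨ht.1, ht.2.le⟩).hasDerivWithinAt) (by simp [h])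
    (fun t ht => (norm_mul_le _ _).trans (mul_le_mul_of_nonneg_right
      (ContinuousLinearMap.le_of_opNorm_le _ (hball _ (hmem t ⟨ht.1, ht.2.le⟩)).1 _)
      (norm_nonneg _))) 1 (by simp)
  simpa [sub_eq_zero] using this

/-- Solutions of `dY = A Y` are as smooth as `A`. -/
theorem contDiffAt_of_parallel {A : E → E →L[ℝ] 𝔸} {x : E} (hA : ContDiffAt ℝ ∞ A x) {Y : E → 𝔸}
    (hY : ∀ᶠ u in 𝓝 x, HasFDerivAt Y ((ContinuousLinearMap.mul ℝ 𝔸).flip (Y u) ∘L A u) u) :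
    ContDiffAt ℝ ∞ Y x := by
  refine contDiffAt_infty.2 fun n => ?_
  induction n with
  | zero =>
    exact contDiffAt_zero.2 ⟨_, hY, fun u hu => HasFDerivAt.continuousAt hu |>.continuousWithinAt⟩
  | succ n ih =>
    refine contDiffAt_succ_iff_hasFDerivAt.2 ⟨_, ⟨_, hY, fun u hu => hu⟩, ?_⟩
    exact ((ContinuousLinearMap.mul ℝ 𝔸).flip.contDiff.contDiffAt.comp x ih).clm_comp
      (hA.of_le (by exact_mod_cast le_top))

end LocalFrame

/-! ### Sections of locally constant cocycles over simply connected spaces -/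

open Topology in
/-- On a simply connected, locally path connected space, local data `g i` on open sets `U i` that
differ from one another by locally constant factors come from a global `s`: the bundle with
discrete fibre glued from the transition functions `(g j)⁻¹ * g i` is a covering, and the identity
lifts to it. -/
theorem exists_global_of_locally_constant_transition {X G : Type*} [TopologicalSpace X]
    [SimplyConnectedSpace X] [LocallyPathConnectedSpace X] [Group G] (U : X → Set X)
    (hU : ∀ i, IsOpen (U i)) (hmem : ∀ i, i ∈ U i) (g : X → X → G)
    (hloc : ∀ i j, ∀ x ∈ U i ∩ U j,
      ∀ᶠ y in 𝓝 x, (g j y)⁻¹ * g i y = (g j x)⁻¹ * g i x) (x₀ : X) :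
    ∃ s : X → G, s x₀ = g x₀ x₀ ∧
      ∀ x, ∀ᶠ y in 𝓝 x, (g x y)⁻¹ * s y = (g x x)⁻¹ * s x := by
  let : TopologicalSpace G := ⊥
  have : DiscreteTopology G := ⟨rfl⟩
  let Z : FiberBundleCore X X G :=
    { baseSet := U
      isOpen_baseSet := hU
      indexAt := id
      mem_baseSet_at := hmem
      coordChange := fun i j x c => (g j x)⁻¹ * g i x * c
      coordChange_self := fun i x _ c => by simp
      continuousOn_coordChange := fun i j => by
        rintro ⟨x, c⟩ ⟨hx, -⟩
        refine ContinuousAt.continuousWithinAt ?_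
        rw [ContinuousAt, nhds_discrete G, Filter.tendsto_pure, nhds_prod_eq, nhds_discrete G,
          Filter.prod_pure, Filter.eventually_map]
        filter_upwards [hloc i j x hx] with y hy
        simp only [hy]
      coordChange_comp := fun i j k x _ c => by
        simp [mul_assoc] }
  have hcov : IsCoveringMap (Bundle.TotalSpace.proj : Bundle.TotalSpace G Z.Fiber → X) :=
    FiberBundle.isCoveringMap
  obtain ⟨σ, ⟨hσ₀, hσ⟩, -⟩ := hcov.existsUnique_continuousMap_lifts (ContinuousMap.id X) x₀
    (⟨x₀, (1 : G)⟩ : Bundle.TotalSpace G Z.Fiber) rfl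
  have hproj : ∀ x, (σ x).1 = x := fun x => congrFun hσ x
  let c : X → G := fun x => (σ x).2
  refine ⟨fun x => g x x * c x, ?_, fun x => ?_⟩
  · have : c x₀ = 1 := by
      simp only [c]
      rw [hσ₀]
    simp [this]
  · have hcont : ContinuousAt (fun y => (Z.localTriv x (σ y)).2) x := by
      have h1 : ContinuousAt (Z.localTriv x) (σ x) :=
        (Z.localTriv x).continuousAt (by
          rw [Z.mem_localTriv_source, hproj]
          exact hmem x)
      exact continuousAt_snd.comp (ContinuousAt.comp h1 σ.continuous.continuousAt)
    rw [ContinuousAt, nhds_discrete G, Filter.tendsto_pure] at hcont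
    have hval : ∀ y, (Z.localTriv x (σ y)).2 = (g x y)⁻¹ * g y y * c y := by
      intro y
      have h1 : (Z.localTriv x (σ y)).2 = (g x (σ y).1)⁻¹ * g (σ y).1 (σ y).1 * c y := rfl
      rw [h1]
      simp only [hproj]
    filter_upwards [hcont] with y hy
    rw [hval, hval] at hy
    simpa [mul_assoc] using hy

noncomputable section

namespace AdSGauss

open Filter Topology

/-! ### Differentials in holomorphic charts -/

section Charts

variable {S : Type*} [TopologicalSpace S] [ChartedSpace ℂ S]
variable {E : Type*} [NormedAddCommGroup E] [NormedSpace ℝ E]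

/-- The real surface underlying a Riemann surface is a smooth manifold. -/
theorem isManifold_real [IsManifold 𝓘(ℂ) ω S] : IsManifold 𝓘(ℝ, ℂ) ∞ S := by
  refine isManifold_of_contDiffOn 𝓘(ℝ, ℂ) ∞ S fun e e' he he' => ?_
  have h2 := (contDiffGroupoid ω 𝓘(ℂ)).compatible he he'
  rw [contDiffGroupoid, mem_groupoid_of_pregroupoid] at h2
  have h3 := h2.1
  simp only [contDiffPregroupoid, modelWithCornersSelf_coe, modelWithCornersSelf_coe_symm,
    Set.range_id, Set.preimage_id, Set.inter_univ, Function.comp_def, id] at h3 ⊢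
  exact (h3.restrict_scalars ℝ).of_le le_top

theorem diffAt_eq_fderiv {f : S → E} {p : S} (hf : MDifferentiableAt 𝓘(ℝ, ℂ) 𝓘(ℝ, E) f p) :
    diffAt f p = fderiv ℝ (f ∘ (chartAt ℂ p).symm) (chartAt ℂ p p) := by
  refine hf.mfderiv.trans ?_
  simp only [writtenInExtChartAt, mfld_simps, fderivWithin_univ]
  rfl

variable [IsManifold 𝓘(ℝ, ℂ) ∞ S]

theorem mdifferentiableAt_chart {p q : S} (hq : q ∈ (chartAt ℂ p).source) :
    MDifferentiableAt 𝓘(ℝ, ℂ) 𝓘(ℝ, ℂ) (chartAt ℂ p) q :=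
  mdifferentiableAt_atlas (chart_mem_atlas ℂ p) hq

theorem mdifferentiableAt_chart_symm {p : S} {u : ℂ} (hu : u ∈ (chartAt ℂ p).target) :
    MDifferentiableAt 𝓘(ℝ, ℂ) 𝓘(ℝ, ℂ) (chartAt ℂ p).symm u :=
  mdifferentiableAt_atlas_symm (chart_mem_atlas ℂ p) hu

theorem mdifferentiableAt_comp_chart {f : ℂ → E} {f' : ℂ →L[ℝ] E} {p q : S}
    (hq : q ∈ (chartAt ℂ p).source) (hf : HasFDerivAt f f' (chartAt ℂ p q)) :
    MDifferentiableAt 𝓘(ℝ, ℂ) 𝓘(ℝ, E) (fun q => f (chartAt ℂ p q)) q ∧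
      diffAt (fun q => f (chartAt ℂ p q)) q = f' ∘L diffAt (chartAt ℂ p) q := by
  have h1 := hf.hasMFDerivAt.comp q (mdifferentiableAt_chart hq).hasMFDerivAt
  exact ⟨h1.mdifferentiableAt, h1.mfderiv⟩

theorem differentiableAt_comp_chart_symm {Y : S → E} {p q : S} (hq : q ∈ (chartAt ℂ p).source)
    (hY : MDifferentiableAt 𝓘(ℝ, ℂ) 𝓘(ℝ, E) Y q) :
    DifferentiableAt ℝ (Y ∘ (chartAt ℂ p).symm) (chartAt ℂ p q) := by
  rw [← mdifferentiableAt_iff_differentiableAt]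
  have h2 := (chartAt ℂ p).left_inv hq
  refine MDifferentiableAt.comp (I' := 𝓘(ℝ, ℂ)) _ (by rw [h2]; exact hY)
    (mdifferentiableAt_chart_symm ((chartAt ℂ p).map_source hq))

/-- The differential of a function is its derivative in any chart, composed with the differential
of the chart. -/
theorem diffAt_eq_fderiv_comp_diffAt_chart {Y : S → E} {p q : S}
    (hq : q ∈ (chartAt ℂ p).source) (hY : MDifferentiableAt 𝓘(ℝ, ℂ) 𝓘(ℝ, E) Y q) :
    diffAt Y q = fderiv ℝ (Y ∘ (chartAt ℂ p).symm) (chartAt ℂ p q) ∘L diffAt (chartAt ℂ p) q := by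
  rw [← (mdifferentiableAt_comp_chart hq
    (differentiableAt_comp_chart_symm hq hY).hasFDerivAt).2]
  refine Filter.EventuallyEq.mfderiv_eq ?_
  filter_upwards [(chartAt ℂ p).open_source.mem_nhds hq] with y hy
  simp [(chartAt ℂ p).left_inv hy]

end Charts

section HolomorphicCharts

variable {S : Type*} [TopologicalSpace S] [ChartedSpace ℂ S] [IsManifold 𝓘(ℂ) ω S]

/-- Coordinate changes of a Riemann surface are holomorphic. -/
theorem analyticAt_transition {p q y : S} (hp : y ∈ (chartAt ℂ p).source)
    (hq : y ∈ (chartAt ℂ q).source) :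
    AnalyticAt ℂ (chartAt ℂ p ∘ (chartAt ℂ q).symm : ℂ → ℂ) (chartAt ℂ q y) := by
  have h2 := (contDiffGroupoid ω 𝓘(ℂ)).compatible (chart_mem_atlas ℂ q) (chart_mem_atlas ℂ p)
  rw [contDiffGroupoid, mem_groupoid_of_pregroupoid] at h2
  have h3 := h2.1
  simp only [contDiffPregroupoid, modelWithCornersSelf_coe, modelWithCornersSelf_coe_symm,
    Set.range_id, Set.preimage_id, Set.inter_univ, Function.comp_def, id] at h3
  have h4 := h3.contDiffAt (x := chartAt ℂ q y)
    (((chartAt ℂ q).symm.trans (chartAt ℂ p)).open_source.mem_nhds (by simp [hp, hq]))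
  exact h4.analyticAt

/-- The differential of a chart is multiplication by a nonzero complex number. -/
theorem exists_diffAt_chart_eq_mul {p q : S} (hq : q ∈ (chartAt ℂ p).source) :
    ∃ a : ℂ, a ≠ 0 ∧ ∀ v, diffAt (chartAt ℂ p) q v = a * v := by
  have : IsManifold 𝓘(ℝ, ℂ) ∞ S := isManifold_real
  have hd : ∀ {p q y : S}, y ∈ (chartAt ℂ p).source → y ∈ (chartAt ℂ q).source →
      HasDerivAt (chartAt ℂ p ∘ (chartAt ℂ q).symm : ℂ → ℂ)
        (deriv (chartAt ℂ p ∘ (chartAt ℂ q).symm : ℂ → ℂ) (chartAt ℂ q y)) (chartAt ℂ q y) :=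
    fun hp hq => (analyticAt_transition hp hq).differentiableAt.hasDerivAt
  have h1 := hd hq (mem_chart_source ℂ q)
  have h2 := hd (mem_chart_source ℂ q) hq
  refine ⟨deriv (chartAt ℂ p ∘ (chartAt ℂ q).symm : ℂ → ℂ) (chartAt ℂ q q), fun h0 => ?_,
    fun v => ?_⟩
  · have h3 : HasDerivAt (fun u => (chartAt ℂ q ∘ (chartAt ℂ p).symm : ℂ → ℂ)
        ((chartAt ℂ p ∘ (chartAt ℂ q).symm : ℂ → ℂ) u)) _ (chartAt ℂ q q) :=
      HasDerivAt.comp (h₂ := (chartAt ℂ q ∘ (chartAt ℂ p).symm : ℂ → ℂ)) (chartAt ℂ q q)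
        (by
          rw [Function.comp_apply, (chartAt ℂ q).left_inv (mem_chart_source ℂ q)]
          exact h2) h1
    have h4 : (fun u => (chartAt ℂ q ∘ (chartAt ℂ p).symm : ℂ → ℂ)
        ((chartAt ℂ p ∘ (chartAt ℂ q).symm : ℂ → ℂ) u)) =ᶠ[𝓝 (chartAt ℂ q q)] id := by
      have := ((chartAt ℂ q).symm.trans (chartAt ℂ p)).open_source.mem_nhds
        (x := chartAt ℂ q q) (by simp [hq])
      filter_upwards [this] with u hu
      simp only [OpenPartialHomeomorph.trans_source, OpenPartialHomeomorph.symm_source,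
        Set.mem_inter_iff, Set.mem_preimage] at hu
      simp [(chartAt ℂ p).left_inv hu.2, (chartAt ℂ q).right_inv hu.1]
    have h5 := h3.unique ((hasDerivAt_id _).congr_of_eventuallyEq h4)
    rw [h0, mul_zero] at h5
    exact zero_ne_one h5
  · rw [diffAt_eq_fderiv (mdifferentiableAt_chart hq),
      (h1.hasFDerivAt.restrictScalars ℝ).fderiv]
    simp [mul_comm]

theorem diffAt_chart_I_mul {p q : S} (hq : q ∈ (chartAt ℂ p).source) (v : ℂ) :
    diffAt (chartAt ℂ p) q (Complex.I * v) = Complex.I * diffAt (chartAt ℂ p) q v := by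
  obtain ⟨a, -, ha⟩ := exists_diffAt_chart_eq_mul hq
  rw [ha, ha, mul_left_comm]

end HolomorphicCharts

/-! ### Global parallel frames on simply connected surfaces -/

section Parallel

variable {S : Type*} [TopologicalSpace S] [ChartedSpace ℂ S]
variable {𝔸 : Type*} [NormedRing 𝔸] [NormedAlgebra ℝ 𝔸]

/-- `A` is flat at `u`: the integrability condition `dA = A ∧ A` of the equation `dY = A Y`. -/
def IsFlatAt (A : ℂ → ℂ →L[ℝ] 𝔸) (u : ℂ) : Prop :=
  ∀ v w, fderiv ℝ A u v w + A u w * A u v = fderiv ℝ A u w v + A u v * A u w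

/-- A flat connection form on a surface: an `𝔸`-valued one-form `α` which in the charts is given
by smooth flat forms. -/
def IsFlatConnection (α : S → ℂ →L[ℝ] 𝔸) : Prop :=
  ∀ p : S, ∃ A : ℂ → ℂ →L[ℝ] 𝔸, ContDiffAt ℝ ∞ A (chartAt ℂ p p) ∧
    (∀ᶠ u in 𝓝 (chartAt ℂ p p), IsFlatAt A u) ∧
    ∀ᶠ q in 𝓝 p, α q = A (chartAt ℂ p q) ∘L diffAt (chartAt ℂ p) q

/-- `Y` satisfies `dY = α Y` at `q`. -/
def IsParallelAt (α : S → ℂ →L[ℝ] 𝔸) (Y : S → 𝔸) (q : S) : Prop :=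
  MDifferentiableAt 𝓘(ℝ, ℂ) 𝓘(ℝ, 𝔸) Y q ∧ ∀ v, diffAt Y q v = α q v * Y q

theorem IsParallelAt.mul_const {α : S → ℂ →L[ℝ] 𝔸} {Y : S → 𝔸} {q : S} (h : IsParallelAt α Y q)
    (c : 𝔸) : IsParallelAt α (fun x => Y x * c) q := by
  have h1 : HasMFDerivAt 𝓘(ℝ, ℂ) 𝓘(ℝ, 𝔸) (fun x => Y x * c) q
      ((ContinuousLinearMap.mul ℝ 𝔸).flip c ∘L diffAt Y q) :=
    (((ContinuousLinearMap.mul ℝ 𝔸).flip c).hasFDerivAt.hasMFDerivAt).comp q h.1.hasMFDerivAt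
  refine ⟨h1.mdifferentiableAt, fun v => ?_⟩
  rw [diffAt, h1.mfderiv]
  change diffAt Y q v * c = _
  rw [h.2, mul_assoc]

theorem IsParallelAt.congr {α : S → ℂ →L[ℝ] 𝔸} {Y Y' : S → 𝔸} {q : S} (h : IsParallelAt α Y q)
    (hY : Y' =ᶠ[𝓝 q] Y) : IsParallelAt α Y' q := by
  refine ⟨h.1.congr_of_eventuallyEq hY, fun v => ?_⟩
  rw [diffAt, hY.mfderiv_eq, hY.eq_of_nhds]
  exact h.2 v

variable [IsManifold 𝓘(ℂ) ω S]

theorem IsParallelAt.hasFDerivAt {α : S → ℂ →L[ℝ] 𝔸} {Y : S → 𝔸} {p q : S}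
    (h : IsParallelAt α Y q) (hq : q ∈ (chartAt ℂ p).source) {A : ℂ → ℂ →L[ℝ] 𝔸}
    (hA : α q = A (chartAt ℂ p q) ∘L diffAt (chartAt ℂ p) q) :
    HasFDerivAt (Y ∘ (chartAt ℂ p).symm)
      ((ContinuousLinearMap.mul ℝ 𝔸).flip ((Y ∘ (chartAt ℂ p).symm) (chartAt ℂ p q)) ∘L
        A (chartAt ℂ p q)) (chartAt ℂ p q) := by
  have : IsManifold 𝓘(ℝ, ℂ) ∞ S := isManifold_real
  have h1 := (differentiableAt_comp_chart_symm hq h.1).hasFDerivAt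
  refine h1.congr_fderiv ?_
  obtain ⟨a, ha, hmul⟩ := exists_diffAt_chart_eq_mul hq
  ext1 v
  have h2 := h.2 (a⁻¹ * v)
  rw [diffAt_eq_fderiv_comp_diffAt_chart hq h.1, hA] at h2
  simp only [ContinuousLinearMap.comp_apply, hmul, mul_inv_cancel_left₀ ha] at h2
  rw [h2]
  simp [(chartAt ℂ p).left_inv hq]

theorem isParallelAt_comp_chart {α : S → ℂ →L[ℝ] 𝔸} {f : ℂ → 𝔸} {p q : S}
    (hq : q ∈ (chartAt ℂ p).source) {A : ℂ → ℂ →L[ℝ] 𝔸}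
    (hA : α q = A (chartAt ℂ p q) ∘L diffAt (chartAt ℂ p) q)
    (hf : HasFDerivAt f ((ContinuousLinearMap.mul ℝ 𝔸).flip (f (chartAt ℂ p q)) ∘L
        A (chartAt ℂ p q)) (chartAt ℂ p q)) :
    IsParallelAt α (fun q => f (chartAt ℂ p q)) q := by
  have : IsManifold 𝓘(ℝ, ℂ) ∞ S := isManifold_real
  have h := mdifferentiableAt_comp_chart hq hf
  refine ⟨h.1, fun v => ?_⟩
  rw [h.2, hA]
  simp

theorem eventually_hasFDerivAt_of_parallel {α : S → ℂ →L[ℝ] 𝔸} {Y : S → 𝔸} {p : S}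
    {A : ℂ → ℂ →L[ℝ] 𝔸}
    (hA : ∀ᶠ q in 𝓝 p, α q = A (chartAt ℂ p q) ∘L diffAt (chartAt ℂ p) q)
    (hY : ∀ᶠ q in 𝓝 p, IsParallelAt α Y q) : ∀ᶠ u in 𝓝 (chartAt ℂ p p),
      HasFDerivAt (Y ∘ (chartAt ℂ p).symm)
        ((ContinuousLinearMap.mul ℝ 𝔸).flip ((Y ∘ (chartAt ℂ p).symm) u) ∘L A u) u := by
  have hsymm : Tendsto (chartAt ℂ p).symm (𝓝 (chartAt ℂ p p)) (𝓝 p) := by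
    have := (chartAt ℂ p).continuousAt_symm (mem_chart_target ℂ p)
    rwa [ContinuousAt, (chartAt ℂ p).left_inv (mem_chart_source ℂ p)] at this
  have htgt := (chartAt ℂ p).open_target.mem_nhds (mem_chart_target ℂ p)
  filter_upwards [hsymm.eventually (hY.and hA), htgt] with u hu ht
  have h1 := hu.1.hasFDerivAt ((chartAt ℂ p).map_target ht) hu.2
  rwa [(chartAt ℂ p).right_inv ht] at h1

/-- Parallel frames that agree at a point agree near it. -/
theorem IsFlatConnection.eventually_eq {α : S → ℂ →L[ℝ] 𝔸} (hα : IsFlatConnection α)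
    {Y₁ Y₂ : S → 𝔸} {p : S} (h₁ : ∀ᶠ q in 𝓝 p, IsParallelAt α Y₁ q)
    (h₂ : ∀ᶠ q in 𝓝 p, IsParallelAt α Y₂ q) (h : Y₁ p = Y₂ p) : ∀ᶠ q in 𝓝 p, Y₁ q = Y₂ q := by
  obtain ⟨A, hA, -, hαA⟩ := hα p
  have hsrc := (chartAt ℂ p).open_source.mem_nhds (mem_chart_source ℂ p)
  have key := fun {Y : S → 𝔸} => eventually_hasFDerivAt_of_parallel (Y := Y) hαA
  have h3 := eventually_eq_of_parallel hA.continuousAt (key h₁) (key h₂)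
    (by simp [(chartAt ℂ p).left_inv (mem_chart_source ℂ p), h])
  filter_upwards [((chartAt ℂ p).continuousAt (mem_chart_source ℂ p)).eventually h3, hsrc]
    with q hq hs
  simpa [(chartAt ℂ p).left_inv hs] using hq

theorem IsFlatConnection.exists_local [CompleteSpace 𝔸] {α : S → ℂ →L[ℝ] 𝔸}
    (hα : IsFlatConnection α) (p : S) :
    ∃ Y : S → 𝔸, Y p = 1 ∧ ∀ᶠ q in 𝓝 p, IsParallelAt α Y q ∧ IsUnit (Y q) := by
  have : IsManifold 𝓘(ℝ, ℂ) ∞ S := isManifold_real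
  obtain ⟨A, hA, hflat, hαA⟩ := hα p
  obtain ⟨f, hf1, hf⟩ := exists_local_parallel_frame
    (hA.of_le (by norm_cast)) hflat
  have hc := (chartAt ℂ p).continuousAt (mem_chart_source ℂ p)
  have hsrc := (chartAt ℂ p).open_source.mem_nhds (mem_chart_source ℂ p)
  have hpar : ∀ᶠ q in 𝓝 p, IsParallelAt α (fun q => f (chartAt ℂ p q)) q := by
    filter_upwards [hc.eventually hf, hαA, hsrc] with q h1 h2 h3
    exact isParallelAt_comp_chart h3 h2 h1
  have hunit : ∀ᶠ q in 𝓝 p, IsUnit (f (chartAt ℂ p q)) :=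
    hpar.self_of_nhds.1.continuousAt.eventually
      (Units.isOpen.mem_nhds (by simp [hf1]))
  exact ⟨fun q => f (chartAt ℂ p q), hf1, hpar.and hunit⟩

/-- On a simply connected Riemann surface a flat connection form has a global parallel frame. -/
theorem IsFlatConnection.exists_global [CompleteSpace 𝔸] [SimplyConnectedSpace S]
    {α : S → ℂ →L[ℝ] 𝔸} (hα : IsFlatConnection α) (p₀ : S) :
    ∃ Y : S → 𝔸, Y p₀ = 1 ∧ ∀ q, IsParallelAt α Y q ∧ IsUnit (Y q) := by
  have : LocallyPathConnectedSpace S := ChartedSpace.locallyPathConnectedSpace ℂ S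
  choose Y hY1 hY using hα.exists_local
  have hU : ∀ p, ∃ U : Set S, IsOpen U ∧ p ∈ U ∧
      ∀ q ∈ U, IsParallelAt α (Y p) q ∧ IsUnit (Y p q) := by
    intro p
    obtain ⟨U, hU, hUo, hpU⟩ := eventually_nhds_iff.1 (hY p)
    exact ⟨U, hUo, hpU, hU⟩
  choose U hUo hmem hUY using hU
  classical
  let g : S → S → 𝔸ˣ := fun p q => if h : IsUnit (Y p q) then h.unit else 1
  have hg : ∀ p, ∀ q ∈ U p, (g p q : 𝔸) = Y p q := by
    intro p q hq
    simp [g, (hUY p q hq).2]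
  have hloc : ∀ i j, ∀ x ∈ U i ∩ U j,
      ∀ᶠ y in 𝓝 x, (g j y)⁻¹ * g i y = (g j x)⁻¹ * g i x := by
    rintro i j x ⟨hi, hj⟩
    have hi' := (hUo i).mem_nhds hi
    have hj' := (hUo j).mem_nhds hj
    have key := hα.eventually_eq (p := x) (Y₁ := Y i)
      (Y₂ := fun y => Y j y * ((g j x)⁻¹ * g i x : 𝔸ˣ))
      (by filter_upwards [hi'] with y hy using (hUY i y hy).1)
      (by filter_upwards [hj'] with y hy using (hUY j y hy).1.mul_const _)
      (by simp [← hg i x hi, ← hg j x hj])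
    filter_upwards [key, hi', hj'] with y hy h1 h2
    rw [inv_mul_eq_iff_eq_mul]
    ext
    rw [← hg i y h1, ← hg j y h2] at hy
    simpa using hy
  obtain ⟨s, hs0, hs⟩ :=
    exists_global_of_locally_constant_transition U hUo hmem g hloc p₀
  refine ⟨fun q => s q, ?_, fun q => ⟨?_, (s q).isUnit⟩⟩
  · change ((s p₀ : 𝔸ˣ) : 𝔸) = 1
    rw [hs0, hg _ _ (hmem p₀), hY1]
  · refine ((hUY q q (hmem q)).1.mul_const (((g q q)⁻¹ * s q : 𝔸ˣ) : 𝔸)).congr ?_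
    filter_upwards [hs q, (hUo q).mem_nhds (hmem q)] with y hy hyU
    rw [← hy, ← hg q y hyU]
    simp

theorem eq_of_diffAt_eq_zero [PreconnectedSpace S] {f : S → ℝ}
    (hf : ∀ q, MDifferentiableAt 𝓘(ℝ, ℂ) 𝓘(ℝ, ℝ) f q) (hf' : ∀ q v, diffAt f q v = 0) (p q : S) :
    f p = f q := by
  have hα : IsFlatConnection (fun _ : S => (0 : ℂ →L[ℝ] ℝ)) := fun p =>
    ⟨fun _ => 0, contDiffAt_const, Eventually.of_forall fun u v w => by simp,
      Eventually.of_forall fun q => by simp⟩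
  have hloc : IsLocallyConstant f := by
    refine (IsLocallyConstant.iff_eventually_eq f).2 fun x => ?_
    refine hα.eventually_eq (Y₁ := f) (Y₂ := fun _ => f x) ?_ ?_ rfl
    · exact Eventually.of_forall fun y => ⟨hf y, fun v => by simp [hf']⟩
    · refine Eventually.of_forall fun y => ⟨mdifferentiableAt_const, fun v => ?_⟩
      rw [diffAt, mfderiv_const]
      change (0 : ℝ) = 0 * f x
      simp
  exact hloc.apply_eq_of_preconnectedSpace p q

end Parallel

/-! ### The Clifford action of `ℝ³` on `ℝ⁴₂` -/

section Algebra

/-- `lorentz` as a continuous bilinear map. -/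
def lorentzL : R31 →L[ℝ] R31 →L[ℝ] ℝ :=
  (LinearMap.mk₂ ℝ lorentz (fun a b c => by simp [lorentz]; ring)
    (fun r a c => by simp [lorentz]; ring) (fun a b c => by simp [lorentz]; ring)
    (fun r a c => by simp [lorentz]; ring)).toContinuousBilinearMap

@[simp] theorem lorentzL_apply (x y : R31) : lorentzL x y = lorentz x y := rfl

/-- `form42` as a continuous bilinear map. -/
def form42L : R42 →L[ℝ] R42 →L[ℝ] ℝ :=
  (LinearMap.mk₂ ℝ form42 (fun a b c => by simp [form42]; ring)
    (fun r a c => by simp [form42]; ring) (fun a b c => by simp [form42]; ring)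
    (fun r a c => by simp [form42]; ring)).toContinuousBilinearMap

@[simp] theorem form42L_apply (x y : R42) : form42L x y = form42 x y := rfl

/-- `formH2R` as a continuous bilinear map. -/
def formH2RL : R31 × ℝ →L[ℝ] R31 × ℝ →L[ℝ] ℝ :=
  (LinearMap.mk₂ ℝ formH2R (fun a b c => by simp [formH2R, lorentz]; ring)
    (fun r a c => by simp [formH2R, lorentz]; ring)
    (fun a b c => by simp [formH2R, lorentz]; ring)
    (fun r a c => by simp [formH2R, lorentz]; ring)).toContinuousBilinearMap

@[simp] theorem formH2RL_apply (x y : R31 × ℝ) : formH2RL x y = formH2R x y := rfl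

/-- The vector product of the Lorentzian `ℝ³`, with `f₀ × f₁ = f₂`, `f₁ × f₂ = -f₀` and
`f₂ × f₀ = f₁` on the canonical basis.  It is the vector part of the Clifford product. -/
def lcross (x y : R31) : R31 :=
  ![-(x 1 * y 2 - x 2 * y 1), x 2 * y 0 - x 0 * y 2, x 0 * y 1 - x 1 * y 0]

/-- `lcross` as a continuous bilinear map. -/
def lcrossL : R31 →L[ℝ] R31 →L[ℝ] R31 :=
  (LinearMap.mk₂ ℝ lcross
    (fun a b c => by ext i; fin_cases i <;> simp [lcross] <;> ring)
    (fun r a c => by ext i; fin_cases i <;> simp [lcross] <;> ring)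
    (fun a b c => by ext i; fin_cases i <;> simp [lcross] <;> ring)
    (fun r a c => by ext i; fin_cases i <;> simp [lcross] <;> ring)).toContinuousBilinearMap

@[simp] theorem lcrossL_apply (x y : R31) : lcrossL x y = lcross x y := rfl

/-- The action of `x ∈ ℝ³` on `ℝ⁴₂` by the skew endomorphism that corresponds to the bivector
`∑ j, x j • frame 1 j` of `Λ²₊`.  When `ℝ⁴₂` is read as the algebra of `2 × 2` matrices, it is the
left multiplication by a matrix of trace zero. -/
def clifford : R31 →L[ℝ] R42 →L[ℝ] R42 :=
  (LinearMap.mk₂ ℝ (fun x u => ![-(x 0 * u 1) + x 1 * u 2 + x 2 * u 3,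
      x 0 * u 0 - x 1 * u 3 + x 2 * u 2, -(x 0 * u 3) + x 1 * u 0 + x 2 * u 1,
      x 0 * u 2 - x 1 * u 1 + x 2 * u 0])
    (fun a b c => by ext i; fin_cases i <;> simp <;> ring)
    (fun r a c => by ext i; fin_cases i <;> simp <;> ring)
    (fun a b c => by ext i; fin_cases i <;> simp <;> ring)
    (fun r a c => by ext i; fin_cases i <;> simp <;> ring)).toContinuousBilinearMap

theorem clifford_apply (x : R31) (u : R42) : clifford x u =
    ![-(x 0 * u 1) + x 1 * u 2 + x 2 * u 3, x 0 * u 0 - x 1 * u 3 + x 2 * u 2,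
      -(x 0 * u 3) + x 1 * u 0 + x 2 * u 1, x 0 * u 2 - x 1 * u 1 + x 2 * u 0] := rfl

theorem lorentz_comm (x y : R31) : lorentz x y = lorentz y x := by
  simp only [lorentz]; ring

theorem form42_comm (x y : R42) : form42 x y = form42 y x := by
  simp only [form42]; ring

theorem lorentz_add_left (x y z : R31) : lorentz (x + y) z = lorentz x z + lorentz y z := by
  simp only [lorentz, Pi.add_apply]; ring

theorem lorentz_add_right (x y z : R31) : lorentz x (y + z) = lorentz x y + lorentz x z := by
  simp only [lorentz, Pi.add_apply]; ring

theorem lorentz_sub_right (x y z : R31) : lorentz x (y - z) = lorentz x y - lorentz x z := by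
  simp only [lorentz, Pi.sub_apply]; ring

theorem lorentz_smul_left (r : ℝ) (x y : R31) : lorentz (r • x) y = r * lorentz x y := by
  simp only [lorentz, Pi.smul_apply, smul_eq_mul]; ring

theorem lorentz_smul_right (r : ℝ) (x y : R31) : lorentz x (r • y) = r * lorentz x y := by
  simp only [lorentz, Pi.smul_apply, smul_eq_mul]; ring

theorem lcross_comm (x y : R31) : lcross x y = -lcross y x := by
  ext i; fin_cases i <;> simp [lcross] <;> ring

@[simp] theorem lcross_self (x : R31) : lcross x x = 0 := by
  ext i; fin_cases i <;> simp [lcross] <;> ring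

theorem lcross_lcross (x y z : R31) :
    lcross x (lcross y z) = lorentz x y • z - lorentz x z • y := by
  ext i; fin_cases i <;> simp [lcross, lorentz] <;> ring

theorem lorentz_lcross_left (x y : R31) : lorentz x (lcross x y) = 0 := by
  simp [lcross, lorentz]; ring

theorem lorentz_lcross_right (x y : R31) : lorentz y (lcross x y) = 0 := by
  simp [lcross, lorentz]; ring

theorem lorentz_lcross_swap (x y z : R31) :
    lorentz (lcross x y) z = -lorentz y (lcross x z) := by
  simp [lcross, lorentz]; ring

/-- The Clifford relation. -/
theorem clifford_clifford (x y : R31) (u : R42) :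
    clifford x (clifford y u) = lorentz x y • u + clifford (lcross x y) u := by
  ext i
  fin_cases i <;> simp [clifford_apply, lorentz, lcross] <;> ring

theorem form42_clifford_self (x : R31) (u : R42) : form42 u (clifford x u) = 0 := by
  simp [clifford_apply, form42]; ring

/-- The orbit maps of the Clifford action are homothetic. -/
theorem form42_clifford_clifford (x y : R31) (u : R42) :
    form42 (clifford x u) (clifford y u) = -(form42 u u * lorentz x y) := by
  simp [clifford_apply, form42, lorentz]; ring

theorem det_clifford (x y z : R31) (u : R42) :
    (Matrix.of ![clifford x u, clifford y u, u, clifford z u]).det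
      = form42 u u ^ 2 * lorentz (lcross x y) z := by
  simp [Matrix.det_succ_row_zero, Fin.sum_univ_succ, Matrix.submatrix_apply, Fin.succAbove,
    clifford_apply, form42, lorentz, lcross]
  ring

/-- Vectors orthogonal to a unit timelike vector are spacelike. -/
theorem lorentz_pos_of_orthogonal {x a : R31} (hx : lorentz x x = -1) (ha : lorentz x a = 0)
    (ha0 : a ≠ 0) : 0 < lorentz a a := by
  simp only [lorentz] at *
  have h0 : 1 ≤ x 0 * x 0 := by nlinarith [mul_self_nonneg (x 1), mul_self_nonneg (x 2)]
  have h1 : (x 0 * a 0) ^ 2 ≤ (x 1 * x 1 + x 2 * x 2) * (a 1 * a 1 + a 2 * a 2) := by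
    have : x 0 * a 0 = x 1 * a 1 + x 2 * a 2 := by linarith
    rw [this]
    nlinarith [sq_nonneg (x 1 * a 2 - x 2 * a 1)]
  have h2 : x 0 * x 0 * (-(a 0 * a 0) + a 1 * a 1 + a 2 * a 2) ≥ a 1 * a 1 + a 2 * a 2 := by
    nlinarith
  have h3 : 0 < a 1 * a 1 + a 2 * a 2 := by
    by_contra h
    have h4 : a 1 = 0 := by nlinarith [mul_self_nonneg (a 1), mul_self_nonneg (a 2)]
    have h5 : a 2 = 0 := by nlinarith [mul_self_nonneg (a 1), mul_self_nonneg (a 2)]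
    have h6 : a 0 = 0 := by
      have : x 0 * a 0 = 0 := by rw [h4, h5] at ha; linarith
      rcases mul_eq_zero.1 this with h | h
      · rw [h] at h0; norm_num at h0
      · exact h
    apply ha0
    ext i; fin_cases i <;> simp [h4, h5, h6]
  by_contra h
  nlinarith

/-! ### Bivectors -/

theorem wedge_eq (u v : R42) : wedge u v =
    (u 0 * v 1 - u 1 * v 0) • wedge (e 0) (e 1) + (u 0 * v 2 - u 2 * v 0) • wedge (e 0) (e 2)
    + (u 0 * v 3 - u 3 * v 0) • wedge (e 0) (e 3) + (u 1 * v 2 - u 2 * v 1) • wedge (e 1) (e 2)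
    + (u 3 * v 1 - u 1 * v 3) • wedge (e 3) (e 1)
    + (u 3 * v 2 - u 2 * v 3) • wedge (e 3) (e 2) := by
  have hup₀ : ∀ a b c : R42, Function.update ![a, c] 0 b = ![b, c] := fun a b c => by
    funext i; fin_cases i <;> rfl
  have hup₁ : ∀ a b c : R42, Function.update ![a, c] 1 b = ![a, b] := fun a b c => by
    funext i; fin_cases i <;> rfl
  have hadd_left : ∀ a b c : R42, wedge (a + b) c = wedge a c + wedge b c := fun a b c => by
    simpa only [wedge, hup₀, hup₁] using
      (exteriorPower.ιMulti ℝ 2 (M := R42)).map_update_add ![a, c] 0 a b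
  have hadd_right : ∀ a b c : R42, wedge a (b + c) = wedge a b + wedge a c := fun a b c => by
    simpa only [wedge, hup₀, hup₁] using
      (exteriorPower.ιMulti ℝ 2 (M := R42)).map_update_add ![a, c] 1 b c
  have hsmul_left : ∀ (r : ℝ) (a c : R42), wedge (r • a) c = r • wedge a c := fun r a c => by
    simpa only [wedge, hup₀, hup₁] using
      (exteriorPower.ιMulti ℝ 2 (M := R42)).map_update_smul ![a, c] 0 r a
  have hsmul_right : ∀ (r : ℝ) (a c : R42), wedge a (r • c) = r • wedge a c := fun r a c => by
    simpa only [wedge, hup₀, hup₁] using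
      (exteriorPower.ιMulti ℝ 2 (M := R42)).map_update_smul ![a, c] 1 r c
  have hself : ∀ a : R42, wedge a a = 0 := fun a =>
    (exteriorPower.ιMulti ℝ 2 (M := R42)).map_eq_zero_of_eq ![a, a] (i := 0) (j := 1) rfl
      (by decide)
  have hswap : ∀ a b : R42, wedge a b = -wedge b a := fun a b => by
    have h := hself (a + b)
    rw [hadd_left, hadd_right, hadd_right, hself, hself, zero_add, add_zero] at h
    exact eq_neg_of_add_eq_zero_left h
  have hu : ∀ u : R42, u = u 0 • e 0 + u 1 • e 1 + u 2 • e 2 + u 3 • e 3 := fun u => by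
    ext i; fin_cases i <;> simp [e]
  conv_lhs => rw [hu u, hu v]
  simp only [hadd_left, hadd_right, hsmul_left, hsmul_right, hself, hswap (e 1) (e 0),
    hswap (e 2) (e 0), hswap (e 3) (e 0), hswap (e 2) (e 1), hswap (e 1) (e 3), hswap (e 2) (e 3)]
  module

theorem toBiv_eq (s : ℝ) (x : R31) : toBiv s x = (1 / √2) •
    (x 0 • (wedge (e 0) (e 1) + s • wedge (e 3) (e 2))
      + x 1 • (wedge (e 0) (e 2) + s • wedge (e 3) (e 1))
      + x 2 • (wedge (e 0) (e 3) + s • wedge (e 1) (e 2))) := by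
  simp only [toBiv, frame, Fin.sum_univ_three, Matrix.cons_val]
  module

/-- The anti-self-dual parts of `(x · u) ∧ (y · u)` and `((x × y) · u) ∧ u` agree, and their
self-dual parts differ by a multiple of `x × y`. -/
theorem wedge_clifford_clifford (x y : R31) (u : R42) :
    wedge (clifford x u) (clifford y u) = wedge (clifford (lcross x y) u) u
      + (form42 u u * √2) • toBiv 1 (lcross x y) := by
  have h2 : √2 * (1 / √2) = 1 := by field_simp
  rw [toBiv_eq, smul_smul, mul_assoc, h2, mul_one, wedge_eq (clifford x u),
    wedge_eq (clifford (lcross x y) u)]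
  simp only [clifford_apply, form42, lcross, Matrix.cons_val]
  module

/-- The self-dual component of the Gauss map of an immersion with tangent plane
`{w · u : w ⊥ x}`. -/
theorem gauss_clifford {x a : R31} {u : R42} (ha : lorentz x a = 0)
    (ha0 : lorentz a a ≠ 0) (hu : form42 u u = -1) :
    (1 / √2) • ((lorentz a a)⁻¹ • wedge (clifford a u) (clifford (lcross x a) u)
      + (1 : ℝ) • wedge (clifford x u) u) = toBiv 1 x := by
  have hcross : lcross a (lcross x a) = -(lorentz a a) • x := by
    rw [lcross_lcross, lorentz_comm a x, ha]; simp
  have h2 : (1 / √2) * √2 = 1 := by field_simp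
  have hw : wedge (clifford (-(lorentz a a) • x) u) u
      = -(lorentz a a) • wedge (clifford x u) u := by
    rw [wedge_eq, wedge_eq (clifford x u)]
    simp only [map_smul, smul_apply, Pi.smul_apply, smul_eq_mul]
    module
  have hb : toBiv 1 (-(lorentz a a) • x) = -(lorentz a a) • toBiv 1 x := by
    simp only [toBiv_eq, Pi.smul_apply, smul_eq_mul]
    module
  rw [wedge_clifford_clifford, hcross, hu, hw, hb]
  match_scalars <;> field_simp
  ring

end Algebra

/-! ### The Laplacian in conformal parameters -/

section PlaneLaplacian

variable {E : Type*} [NormedAddCommGroup E] [NormedSpace ℝ E]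
variable {G : Type*} [NormedAddCommGroup G] [NormedSpace ℝ G]

/-- The flat Laplacian `f_xx + f_yy` of a map on `ℂ`. -/
def planeLaplacian (f : ℂ → E) (u : ℂ) : E :=
  fderiv ℝ (fderiv ℝ f) u 1 1 + fderiv ℝ (fderiv ℝ f) u Complex.I Complex.I

theorem ContDiffAt.differentiableAt_fderiv {f : ℂ → E} {u : ℂ} (hf : ContDiffAt ℝ 2 f u) :
    DifferentiableAt ℝ (fderiv ℝ f) u :=
  (hf.fderiv_right (m := 1) (by norm_num)).differentiableAt (by norm_num)

theorem planeLaplacian_clm_comp (L : E →L[ℝ] G) {f : ℂ → E} {u : ℂ} (hf : ContDiffAt ℝ 2 f u) :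
    planeLaplacian (fun z => L (f z)) u = L (planeLaplacian f u) := by
  have h1 : fderiv ℝ (fun z => L (f z)) =ᶠ[𝓝 u] fun z => L ∘L fderiv ℝ f z := by
    filter_upwards [hf.eventually (by simp)] with z hz
    exact (L.hasFDerivAt.comp z (hz.differentiableAt (by simp)).hasFDerivAt).fderiv
  have h2 : fderiv ℝ (fun z => L ∘L fderiv ℝ f z) u
      = (ContinuousLinearMap.compL ℝ ℂ E G L) ∘L fderiv ℝ (fderiv ℝ f) u :=
    ((ContinuousLinearMap.compL ℝ ℂ E G L).hasFDerivAt.comp u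
      (ContDiffAt.differentiableAt_fderiv hf).hasFDerivAt).fderiv
  simp [planeLaplacian, h1.fderiv_eq, h2]

/-- A bilinear map on `ℂ` has the same trace over `(a, i a)` as over `(1, i)`, up to the
factor `|a|²`. -/
theorem trace_mul_eq (B : ℂ →L[ℝ] ℂ →L[ℝ] E) (a : ℂ) :
    B a a + B (a * Complex.I) (a * Complex.I)
      = ‖a‖ ^ 2 • (B 1 1 + B Complex.I Complex.I) := by
  have h1 : a = a.re • (1 : ℂ) + a.im • Complex.I := by simp
  have h2 : a * Complex.I = (-a.im) • (1 : ℂ) + a.re • Complex.I := by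
    apply Complex.ext <;> simp
  have h3 : ‖a‖ ^ 2 = a.re * a.re + a.im * a.im := by
    rw [Complex.sq_norm, Complex.normSq_apply]
  rw [h2, h3]
  nth_rewrite 1 2 [h1]
  simp only [map_add, map_smul, add_apply, smul_apply]
  module

/-- Conformal invariance of the Laplacian in dimension two. -/
theorem planeLaplacian_comp_analytic {f : ℂ → E} {τ : ℂ → ℂ} {u : ℂ} (hτ : AnalyticAt ℂ τ u)
    (hf : ContDiffAt ℝ 2 f (τ u)) :
    planeLaplacian (f ∘ τ) u = ‖deriv τ u‖ ^ 2 • planeLaplacian f (τ u) := by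
  have h1 : fderiv ℝ (f ∘ τ) =ᶠ[𝓝 u]
      fun z => (fderiv ℝ f (τ z)).comp (deriv τ z • (1 : ℂ →L[ℝ] ℂ)) := by
    filter_upwards [hτ.eventually_analyticAt, hτ.continuousAt.eventually
      (hf.eventually (by simp))] with z hz hz'
    exact ((hz'.differentiableAt (by simp)).hasFDerivAt.comp z
      hz.differentiableAt.hasDerivAt.complexToReal_fderiv).fderiv
  have h2 : HasFDerivAt (fun z => fderiv ℝ f (τ z))
      ((fderiv ℝ (fderiv ℝ f) (τ u)).comp (deriv τ u • (1 : ℂ →L[ℝ] ℂ))) u :=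
    (ContDiffAt.differentiableAt_fderiv hf).hasFDerivAt.comp u
      hτ.differentiableAt.hasDerivAt.complexToReal_fderiv
  have h3 := hτ.deriv.differentiableAt.hasDerivAt.complexToReal_fderiv.smul_const (1 : ℂ →L[ℝ] ℂ)
  have h4 := (h2.clm_comp h3).fderiv
  have h5 := trace_mul_eq (fderiv ℝ (fderiv ℝ f) (τ u)) (deriv τ u)
  rw [planeLaplacian, planeLaplacian, ← h5, h1.fderiv_eq, h4]
  have h6 : (deriv (deriv τ) u * Complex.I) * Complex.I = -deriv (deriv τ) u := by
    rw [mul_assoc, Complex.I_mul_I]; ring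
  simp [h6]
  abel

/-- The tension field of a conformal map is orthogonal to its image: if the form induced by `F` is
conformal near `u`, then `F_xx + F_yy` is orthogonal to `F_x` and `F_y`. -/
theorem planeLaplacian_orthogonal_of_conformal (B : E →L[ℝ] E →L[ℝ] ℝ)
    (hB : ∀ x y, B x y = B y x) {F : ℂ → E} {u : ℂ} (hF : ContDiffAt ℝ 2 F u)
    (hconf : ∀ᶠ z in 𝓝 u, ∃ k : ℝ, ∀ v w : ℂ,
      B (fderiv ℝ F z v) (fderiv ℝ F z w) = k * (v * starRingEnd ℂ w).re) :
    B (planeLaplacian F u) (fderiv ℝ F u 1) = 0 ∧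
      B (planeLaplacian F u) (fderiv ℝ F u Complex.I) = 0 := by
  have hd := (ContDiffAt.differentiableAt_fderiv hF).hasFDerivAt
  have hsymm : ∀ v w, fderiv ℝ (fderiv ℝ F) u v w = fderiv ℝ (fderiv ℝ F) u w v :=
    hF.isSymmSndFDerivAt (by simp)
  have happ : ∀ v : ℂ, HasFDerivAt (fun z => fderiv ℝ F z v)
      ((fderiv ℝ (fderiv ℝ F) u).flip v) u := fun v => by
    simpa using hd.clm_apply (hasFDerivAt_const v u)
  have hpair : ∀ v w : ℂ, HasFDerivAt (fun z => B (fderiv ℝ F z v) (fderiv ℝ F z w)) _ u :=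
    fun v w => B.hasFDerivAt_of_bilinear (happ v) (happ w)
  have h1 : (fun z => B (fderiv ℝ F z 1) (fderiv ℝ F z 1)
      - B (fderiv ℝ F z Complex.I) (fderiv ℝ F z Complex.I)) =ᶠ[𝓝 u] fun _ => (0 : ℝ) := by
    filter_upwards [hconf] with z ⟨k, hk⟩
    simp [hk]
  have h2 : (fun z => B (fderiv ℝ F z 1) (fderiv ℝ F z Complex.I)) =ᶠ[𝓝 u]
      fun _ => (0 : ℝ) := by
    filter_upwards [hconf] with z ⟨k, hk⟩
    simp [hk]
  have e1 := ((hpair 1 1).sub (hpair Complex.I Complex.I)).unique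
    ((hasFDerivAt_const (0 : ℝ) u).congr_of_eventuallyEq h1)
  have e2 := (hpair 1 Complex.I).unique
    ((hasFDerivAt_const (0 : ℝ) u).congr_of_eventuallyEq h2)
  have e11 := DFunLike.congr_fun e1 1
  have e1I := DFunLike.congr_fun e1 Complex.I
  have e21 := DFunLike.congr_fun e2 1
  have e2I := DFunLike.congr_fun e2 Complex.I
  simp only [sub_apply, add_apply, zero_apply, ContinuousLinearMap.precompR_apply,
    ContinuousLinearMap.precompL_apply, ContinuousLinearMap.flip_apply,
    ContinuousLinearMap.compL_apply, ContinuousLinearMap.comp_apply] at e11 e1I e21 e2I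
  rw [hsymm Complex.I 1] at e1I e2I
  simp only [planeLaplacian, map_add, add_apply]
  have s1 : ∀ x, B (fderiv ℝ F u 1) x = B x (fderiv ℝ F u 1) := fun x => hB _ x
  have s2 : ∀ x, B (fderiv ℝ F u Complex.I) x = B x (fderiv ℝ F u Complex.I) := fun x => hB _ x
  simp only [s1, s2] at e11 e1I e21 e2I
  constructor <;> linarith

end PlaneLaplacian

section ChartLaplacian

variable {S : Type*} [TopologicalSpace S] [ChartedSpace ℂ S] [IsManifold 𝓘(ℂ) ω S]
variable {E : Type*} [NormedAddCommGroup E] [NormedSpace ℝ E]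

theorem contDiffAt_comp_chart_symm {f : S → E} (hf : ContMDiff 𝓘(ℝ, ℂ) 𝓘(ℝ, E) ∞ f) {p : S}
    {u : ℂ} (hu : u ∈ (chartAt ℂ p).target) : ContDiffAt ℝ ∞ (f ∘ (chartAt ℂ p).symm) u := by
  have : IsManifold 𝓘(ℝ, ℂ) ∞ S := isManifold_real
  rw [← contMDiffAt_iff_contDiffAt]
  exact hf.contMDiffAt.comp u
    ((contMDiffOn_chart_symm (x := p)).contMDiffAt ((chartAt ℂ p).open_target.mem_nhds hu))

theorem contMDiffAt_of_contDiffAt_comp_chart_symm {f : S → E} {p : S}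
    (hf : ContDiffAt ℝ ∞ (f ∘ (chartAt ℂ p).symm) (chartAt ℂ p p)) :
    ContMDiffAt 𝓘(ℝ, ℂ) 𝓘(ℝ, E) ∞ f p := by
  have : IsManifold 𝓘(ℝ, ℂ) ∞ S := isManifold_real
  have h1 : ContMDiffAt 𝓘(ℝ, ℂ) 𝓘(ℝ, ℂ) ∞ (chartAt ℂ p) p :=
    (contMDiffOn_chart (x := p)).contMDiffAt (chart_source_mem_nhds ℂ p)
  have h2 := (contMDiffAt_iff_contDiffAt.2 hf).comp p h1
  refine h2.congr_of_eventuallyEq ?_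
  filter_upwards [chart_source_mem_nhds ℂ p] with y hy
  simp [(chartAt ℂ p).left_inv hy]

/-- Up to a factor, the Laplacian in a chart at `q` is the one in the preferred chart at `q`. -/
theorem exists_planeLaplacian_chart_eq_smul {f : S → E} (hf : ContMDiff 𝓘(ℝ, ℂ) 𝓘(ℝ, E) ∞ f)
    {p q : S} (hq : q ∈ (chartAt ℂ p).source) :
    ∃ r : ℝ, planeLaplacian (f ∘ (chartAt ℂ p).symm) (chartAt ℂ p q)
      = r • planeLaplacian (f ∘ (chartAt ℂ q).symm) (chartAt ℂ q q) := by
  set τ : ℂ → ℂ := chartAt ℂ q ∘ (chartAt ℂ p).symm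
  have hτq : τ (chartAt ℂ p q) = chartAt ℂ q q := by simp [τ, (chartAt ℂ p).left_inv hq]
  have h1 := planeLaplacian_comp_analytic (f := f ∘ (chartAt ℂ q).symm) (τ := τ)
    (u := chartAt ℂ p q) (analyticAt_transition (mem_chart_source ℂ q) hq)
    (by
      rw [hτq]
      exact (contDiffAt_comp_chart_symm hf (mem_chart_target ℂ q)).of_le (by norm_cast))
  rw [hτq] at h1
  refine ⟨_, Eq.trans ?_ h1⟩
  have h2 : f ∘ (chartAt ℂ p).symm =ᶠ[𝓝 (chartAt ℂ p q)] (f ∘ (chartAt ℂ q).symm) ∘ τ := by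
    have := ((chartAt ℂ p).symm.trans (chartAt ℂ q)).open_source.mem_nhds
      (x := chartAt ℂ p q) (by simp [(chartAt ℂ p).map_source hq, (chartAt ℂ p).left_inv hq])
    filter_upwards [this] with u hu
    simp only [OpenPartialHomeomorph.trans_source, OpenPartialHomeomorph.symm_source,
      Set.mem_inter_iff, Set.mem_preimage] at hu
    simp [τ, (chartAt ℂ q).left_inv hu.2]
  rw [planeLaplacian, planeLaplacian, (h2.fderiv).fderiv_eq]

/-- A conformal map is conformal in every chart. -/
theorem exists_conformal_factor_in_chart {B : E → E → ℝ} {f : S → E} {p q : S}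
    (hq : q ∈ (chartAt ℂ p).source) (hf : MDifferentiableAt 𝓘(ℝ, ℂ) 𝓘(ℝ, E) f q) {k : ℝ}
    (hk : ∀ v w : ℂ, B (diffAt f q v) (diffAt f q w) = k * (v * starRingEnd ℂ w).re) :
    ∃ k' : ℝ, ∀ v w : ℂ, B (fderiv ℝ (f ∘ (chartAt ℂ p).symm) (chartAt ℂ p q) v)
      (fderiv ℝ (f ∘ (chartAt ℂ p).symm) (chartAt ℂ p q) w) = k' * (v * starRingEnd ℂ w).re := by
  have : IsManifold 𝓘(ℝ, ℂ) ∞ S := isManifold_real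
  obtain ⟨a, ha, hmul⟩ := exists_diffAt_chart_eq_mul hq
  have h1 : ∀ v, fderiv ℝ (f ∘ (chartAt ℂ p).symm) (chartAt ℂ p q) v = diffAt f q (a⁻¹ * v) := by
    intro v
    rw [diffAt_eq_fderiv_comp_diffAt_chart hq hf]
    simp [hmul, mul_inv_cancel_left₀ ha]
  refine ⟨k * Complex.normSq a⁻¹, fun v w => ?_⟩
  rw [h1, h1, hk]
  have h2 : a⁻¹ * v * starRingEnd ℂ (a⁻¹ * w)
      = (Complex.normSq a⁻¹ : ℂ) * (v * starRingEnd ℂ w) := by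
    rw [map_mul, ← Complex.mul_conj]; ring
  rw [h2, Complex.re_ofReal_mul, mul_assoc]

end ChartLaplacian

/-! ### Minimal immersions into `ℍ² × ℝ` and harmonic maps -/

section Diff

variable {S : Type*} [TopologicalSpace S] [ChartedSpace ℂ S]
variable {E : Type*} [NormedAddCommGroup E] [NormedSpace ℝ E]
variable {G : Type*} [NormedAddCommGroup G] [NormedSpace ℝ G]
variable {H : Type*} [NormedAddCommGroup H] [NormedSpace ℝ H]

theorem diffAt_comp {f : S → E} {p : S} (hf : MDifferentiableAt 𝓘(ℝ, ℂ) 𝓘(ℝ, E) f p)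
    {F : E → G} {F' : E →L[ℝ] G} (hF : HasFDerivAt F F' (f p)) :
    MDifferentiableAt 𝓘(ℝ, ℂ) 𝓘(ℝ, G) (fun q => F (f q)) p ∧
      ∀ v, diffAt (fun q => F (f q)) p v = F' (diffAt f p v) := by
  have h := hF.hasMFDerivAt.comp p hf.hasMFDerivAt
  exact ⟨h.mdifferentiableAt, fun v => DFunLike.congr_fun h.mfderiv v⟩

theorem diffAt_bilinear (B : E →L[ℝ] G →L[ℝ] H) {f : S → E} {g : S → G} {p : S}
    (hf : MDifferentiableAt 𝓘(ℝ, ℂ) 𝓘(ℝ, E) f p) (hg : MDifferentiableAt 𝓘(ℝ, ℂ) 𝓘(ℝ, G) g p) :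
    MDifferentiableAt 𝓘(ℝ, ℂ) 𝓘(ℝ, H) (fun q => B (f q) (g q)) p ∧
      ∀ v, diffAt (fun q => B (f q) (g q)) p v
        = B (f p) (diffAt g p v) + B (diffAt f p v) (g p) := by
  have h1 : HasMFDerivAt 𝓘(ℝ, ℂ) 𝓘(ℝ, E × G) (fun q => (f q, g q)) p
      ((diffAt f p).prod (diffAt g p)) :=
    ⟨hf.hasMFDerivAt.1.prodMk hg.hasMFDerivAt.1, hf.hasMFDerivAt.2.prodMk hg.hasMFDerivAt.2⟩
  have h2 : HasFDerivAt (fun x : E × G => B x.1 x.2) _ (f p, g p) :=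
    B.hasFDerivAt_of_bilinear hasFDerivAt_fst hasFDerivAt_snd
  have h := h2.hasMFDerivAt.comp p h1
  exact ⟨h.mdifferentiableAt, fun v => DFunLike.congr_fun h.mfderiv v⟩

end Diff

section Minimal

variable {S : Type*} [TopologicalSpace S] [ChartedSpace ℂ S]

/-- The components `(η, h)` of a conformal minimal immersion into `ℍ² × ℝ` whose height `h` has no
critical points: `η` and `h` are harmonic, and the Hopf differential of `η` is the opposite of the
square of `∂h`. -/
structure IsMinimalPair (η : S → R31) (h : S → ℝ) : Prop where
  smooth_fst : ContMDiff 𝓘(ℝ, ℂ) 𝓘(ℝ, R31) ∞ η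
  smooth_snd : ContMDiff 𝓘(ℝ, ℂ) 𝓘(ℝ, ℝ) ∞ h
  unit : ∀ p, lorentz (η p) (η p) = -1
  norm_eq : ∀ p, lorentz (diffAt η p 1) (diffAt η p 1) + diffAt h p 1 ^ 2
    = lorentz (diffAt η p Complex.I) (diffAt η p Complex.I) + diffAt h p Complex.I ^ 2
  orthogonal : ∀ p, lorentz (diffAt η p 1) (diffAt η p Complex.I)
    + diffAt h p 1 * diffAt h p Complex.I = 0
  regular : ∀ p, diffAt h p 1 ≠ 0 ∨ diffAt h p Complex.I ≠ 0
  harmonic_fst : ∀ p, ∀ᶠ u in 𝓝 (chartAt ℂ p p), ∃ l : ℝ,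
    planeLaplacian (η ∘ (chartAt ℂ p).symm) u = l • (η ∘ (chartAt ℂ p).symm) u
  harmonic_snd : ∀ p, ∀ᶠ u in 𝓝 (chartAt ℂ p p), planeLaplacian (h ∘ (chartAt ℂ p).symm) u = 0

theorem lorentz_diffAt_eq_zero {η : S → R31} {p : S}
    (hη : MDifferentiableAt 𝓘(ℝ, ℂ) 𝓘(ℝ, R31) η p) {r : ℝ} (h : ∀ q, lorentz (η q) (η q) = r)
    (v : ℂ) : lorentz (η p) (diffAt η p v) = 0 := by
  have h1 := (diffAt_bilinear lorentzL hη hη).2 v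
  have h2 : (fun q => lorentzL (η q) (η q)) = fun _ => r := funext h
  rw [h2, diffAt, mfderiv_const] at h1
  have h3 : (0 : ℝ) = lorentz (η p) (diffAt η p v) + lorentz (diffAt η p v) (η p) := h1
  rw [lorentz_comm (diffAt η p v)] at h3
  linarith

theorem eq_smul_of_lcross_eq_zero {x m : R31} (hx : lorentz x x = -1) (h : lcross x m = 0) :
    m = -lorentz x m • x := by
  have h3 := lcross_lcross x x m
  have h4 : lcross x 0 = 0 := (lcrossL x).map_zero
  rw [h, hx, h4] at h3
  have h5 : m + lorentz x m • x = 0 := by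
    calc m + lorentz x m • x = -((-1 : ℝ) • m - lorentz x m • x) := by module
      _ = 0 := by rw [← h3, neg_zero]
  rw [neg_smul]
  exact eq_neg_of_add_eq_zero_left h5

/-- In the tangent plane of `ℍ²` at `x`, a vector orthogonal to two orthogonal nonnull vectors
vanishes. -/
theorem eq_zero_of_lorentz_orthogonal {x X Y n : R31} (hx : lorentz x x = -1)
    (hxX : lorentz x X = 0) (hxY : lorentz x Y = 0) (hXY : lorentz X Y = 0)
    (hX : lorentz X X ≠ 0) (hY : lorentz Y Y ≠ 0) (hxn : lorentz x n = 0)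
    (hXn : lorentz X n = 0) (hYn : lorentz Y n = 0) : n = 0 := by
  have h1 : lcross x (lcross X n) = 0 := by rw [lcross_lcross, hxX, hxn]; simp
  have h2 : lcross Y (lcross X n) = 0 := by rw [lcross_lcross, lorentz_comm Y X, hXY, hYn]; simp
  set m := lcross X n
  obtain ⟨t, ht⟩ : ∃ t : ℝ, m = t • x := ⟨_, eq_smul_of_lcross_eq_zero hx h1⟩
  have h6 := lcross_lcross Y Y m
  rw [h2, ht] at h6
  have h4 : lcross Y 0 = 0 := (lcrossL Y).map_zero
  have h7 : lorentz Y (t • x) = 0 := by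
    rw [lorentz_smul_right, lorentz_comm, hxY, mul_zero]
  have hx0 : x ≠ 0 := by
    rintro rfl
    simp [lorentz] at hx
  rw [h4, h7, zero_smul, sub_zero, eq_comm, smul_eq_zero, smul_eq_zero] at h6
  have ht0 : t = 0 := by tauto
  have h8 := lcross_lcross X X n
  have h9 : lcross X n = 0 := by rw [← zero_smul ℝ x, ← ht0]; exact ht
  have h10 : lcross X 0 = 0 := (lcrossL X).map_zero
  rw [h9, h10, hXn, zero_smul, sub_zero, eq_comm, smul_eq_zero] at h8
  tauto

variable [IsManifold 𝓘(ℂ) ω S]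

/-- A conformal minimal immersion into `ℍ² × ℝ` is harmonic: its Laplacian is normal to
`ℍ² × ℝ`. -/
theorem planeLaplacian_eq_of_minimal
    {g : ∀ p : S, TangentSpace 𝓘(ℝ, ℂ) p → TangentSpace 𝓘(ℝ, ℂ) p → ℝ}
    (hg : IsConformalMetric g) {φ : S → R31 × ℝ} (hφ_mem : ∀ p, φ p ∈ H2R)
    (hφ_isom : IsIsometricImmersion g formH2R φ)
    (hφ_min : HasZeroMeanCurvature formH2R tangentH2R φ) (p : S) :
    ∃ l : ℝ, planeLaplacian (φ ∘ (chartAt ℂ p).symm) (chartAt ℂ p p) = (l • (φ p).1, 0) := by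
  have : IsManifold 𝓘(ℝ, ℂ) ∞ S := isManifold_real
  have hsm := hφ_isom.1
  have hmd : ∀ q, MDifferentiableAt 𝓘(ℝ, ℂ) 𝓘(ℝ, R31 × ℝ) φ q :=
    fun q => hsm.contMDiffAt.mdifferentiableAt (by simp)
  obtain ⟨k, hk, hgk⟩ := hg p
  have hiso : ∀ v w : ℂ, formH2R (diffAt φ p v) (diffAt φ p w) = k * (v * starRingEnd ℂ w).re :=
    fun v w => (hφ_isom.2 p v w).trans (hgk v w)
  set F := φ ∘ (chartAt ℂ p).symm
  set u := chartAt ℂ p p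
  have hF : ContDiffAt ℝ 2 F u :=
    (contDiffAt_comp_chart_symm hsm (mem_chart_target ℂ p)).of_le (by norm_cast)
  have hdF : fderiv ℝ F u = diffAt φ p := (diffAt_eq_fderiv (hmd p)).symm
  have hcomm : ∀ x y, formH2R x y = formH2R y x := fun x y => by
    simp only [formH2R, lorentz]; ring
  have hconf : ∀ᶠ z in 𝓝 u, ∃ k : ℝ, ∀ v w : ℂ,
      formH2RL (fderiv ℝ F z v) (fderiv ℝ F z w) = k * (v * starRingEnd ℂ w).re := by
    filter_upwards [(chartAt ℂ p).open_target.mem_nhds (mem_chart_target ℂ p)] with z hz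
    have hq := (chartAt ℂ p).map_target hz
    obtain ⟨k', -, hk'⟩ := hg ((chartAt ℂ p).symm z)
    have := exists_conformal_factor_in_chart (B := formH2R) hq (hmd _)
      (fun v w => (hφ_isom.2 _ v w).trans (hk' v w))
    rwa [(chartAt ℂ p).right_inv hz] at this
  have horth := planeLaplacian_orthogonal_of_conformal formH2RL hcomm hF hconf
  rw [hdF] at horth
  have htan : ∀ v, lorentz (φ p).1 (diffAt φ p v).1 = 0 := fun v => by
    have h1 := diffAt_comp (hmd p) (ContinuousLinearMap.fst ℝ R31 ℝ).hasFDerivAt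
    have h2 := lorentz_diffAt_eq_zero h1.1 (r := -1) (fun q => (hφ_mem q).1) v
    rwa [h1.2] at h2
  set P := planeLaplacian F u
  -- zero mean curvature, on the orthonormal basis `(k⁻¹ᐟ² ∂_x, k⁻¹ᐟ² ∂_y)`
  have hnormal : ∀ ξ ∈ tangentH2R (φ p), (∀ v, formH2R ξ (diffAt φ p v) = 0) →
      formH2R P ξ = 0 := by
    intro ξ hξ hξn
    obtain ⟨s, hs⟩ : ∃ s : ℝ, s * s = k⁻¹ :=
      ⟨√k⁻¹, Real.mul_self_sqrt (inv_nonneg.2 hk.le)⟩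
    have h1 := hφ_min p ξ hξ hξn (s • (1 : ℂ)) (s • Complex.I)
      (by
        rw [hiso]
        simp [hs, hk.ne'])
      (by
        rw [hiso]
        simp [hs, hk.ne'])
      (by rw [hiso]; simp)
    simp only [secondDiffAt] at h1
    simp only [map_smul, smul_apply, smul_smul, hs, ← formH2RL_apply] at h1
    rw [← smul_add, smul_eq_mul] at h1
    have h4 : formH2RL P ξ = formH2RL (fderiv ℝ (fderiv ℝ F) u 1 1) ξ
        + formH2RL (fderiv ℝ (fderiv ℝ F) u Complex.I Complex.I) ξ := by
      simp [P, planeLaplacian]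
    rw [← formH2RL_apply, h4]
    exact (mul_eq_zero.1 h1).resolve_left (inv_ne_zero hk.ne')
  -- subtract from `w` its projection to the tangent plane of the surface
  have htangent : ∀ w ∈ tangentH2R (φ p), formH2R P w = 0 := by
    intro w hw
    set a := k⁻¹ * formH2R w (diffAt φ p 1)
    set b := k⁻¹ * formH2R w (diffAt φ p Complex.I)
    have h1 := hnormal (w - a • diffAt φ p 1 - b • diffAt φ p Complex.I)
      (by
        have hw' : lorentz (φ p).1 w.1 = 0 := hw
        change lorentz (φ p).1 (w.1 - a • (diffAt φ p 1).1 - b • (diffAt φ p Complex.I).1) = 0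
        simp [lorentz_sub_right, lorentz_smul_right, hw', htan])
      (by
        have hbase : ∀ v : ℂ, v = v.re • (1 : ℂ) + v.im • Complex.I := fun v => by simp
        intro v
        rw [← formH2RL_apply, hbase v]
        simp only [map_sub, map_smul, map_add, sub_apply, smul_apply, formH2RL_apply, smul_eq_mul,
          hiso, a, b]
        simp
        field_simp
        ring)
    rw [← formH2RL_apply, map_sub, map_sub, map_smul, map_smul, horth.1, horth.2] at h1
    simpa using h1
  refine ⟨-lorentz P.1 (φ p).1, Prod.ext ?_ ?_⟩
  · have hunit := (hφ_mem p).1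
    have h1 : ∀ x : R31, lorentz (P.1 + lorentz P.1 (φ p).1 • (φ p).1) x = 0 := by
      intro x
      have h2 := htangent (x + lorentz x (φ p).1 • (φ p).1, 0) (by
        change lorentz (φ p).1 (x + lorentz x (φ p).1 • (φ p).1) = 0
        simp [lorentz_add_right, lorentz_smul_right, hunit, lorentz_comm x])
      simp only [formH2R, mul_zero, add_zero, lorentz_add_right, lorentz_smul_right] at h2
      rw [lorentz_add_left, lorentz_smul_left, lorentz_comm (φ p).1 x]
      linarith
    have h3 : P.1 + lorentz P.1 (φ p).1 • (φ p).1 = 0 := by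
      set y := P.1 + lorentz P.1 (φ p).1 • (φ p).1
      ext i
      have h4 := h1 (Pi.single i 1)
      fin_cases i <;> simpa [lorentz] using h4
    rw [neg_smul]
    exact eq_neg_of_add_eq_zero_left h3
  · have h1 := htangent (0, 1) (by simp [tangentH2R, lorentz])
    simpa [formH2R, lorentz] using h1

/-- At a critical point of `h` the unit normal would be vertical, with angle function `± 1`. -/
theorem isMinimalPair_of_minimal
    {g : ∀ p : S, TangentSpace 𝓘(ℝ, ℂ) p → TangentSpace 𝓘(ℝ, ℂ) p → ℝ}
    (hg : IsConformalMetric g) {φ N : S → R31 × ℝ} (hφ_mem : ∀ p, φ p ∈ H2R)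
    (hφ_isom : IsIsometricImmersion g formH2R φ)
    (hφ_min : HasZeroMeanCurvature formH2R tangentH2R φ)
    (hN : IsUnitNormalH2R φ N) (hν : ∀ p, angle N p ^ 2 < 1) :
    IsMinimalPair (fun p => (φ p).1) (fun p => (φ p).2) := by
  have hsm := hφ_isom.1
  have hmd : ∀ q, MDifferentiableAt 𝓘(ℝ, ℂ) 𝓘(ℝ, R31 × ℝ) φ q :=
    fun q => hsm.contMDiffAt.mdifferentiableAt (by simp)
  have hd1 := fun p => diffAt_comp (hmd p) (ContinuousLinearMap.fst ℝ R31 ℝ).hasFDerivAt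
  have hd2 := fun p => diffAt_comp (hmd p) (ContinuousLinearMap.snd ℝ R31 ℝ).hasFDerivAt
  have h1 : ∀ p v, diffAt (fun q => (φ q).1) p v = (diffAt φ p v).1 := fun p v => (hd1 p).2 v
  have h2 : ∀ p v, diffAt (fun q => (φ q).2) p v = (diffAt φ p v).2 := fun p v => (hd2 p).2 v
  have hlap : ∀ p, ∀ᶠ u in 𝓝 (chartAt ℂ p p), ContDiffAt ℝ 2 (φ ∘ (chartAt ℂ p).symm) u ∧
      ∃ l : ℝ, planeLaplacian (φ ∘ (chartAt ℂ p).symm) u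
        = (l • ((φ ∘ (chartAt ℂ p).symm) u).1, 0) := by
    intro p
    filter_upwards [(chartAt ℂ p).open_target.mem_nhds (mem_chart_target ℂ p)] with u hu
    refine ⟨(contDiffAt_comp_chart_symm hsm hu).of_le (by norm_cast), ?_⟩
    have hq := (chartAt ℂ p).map_target hu
    obtain ⟨r, hr⟩ := exists_planeLaplacian_chart_eq_smul hsm hq
    obtain ⟨l, hl⟩ := planeLaplacian_eq_of_minimal hg hφ_mem hφ_isom hφ_min ((chartAt ℂ p).symm u)
    rw [(chartAt ℂ p).right_inv hu, hl] at hr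
    exact ⟨r * l, by rw [hr]; simp [mul_smul]⟩
  have hunit : ∀ p, lorentz (φ p).1 (φ p).1 = -1 := fun p => (hφ_mem p).1
  refine ⟨?_, ?_, hunit, fun p => ?_, fun p => ?_, fun p => ?_, fun p => ?_, fun p => ?_⟩
  · exact (ContinuousLinearMap.fst ℝ R31 ℝ).contDiff.contMDiff.comp hsm
  · exact (ContinuousLinearMap.snd ℝ R31 ℝ).contDiff.contMDiff.comp hsm
  · obtain ⟨k, hk, hgk⟩ := hg p
    have e1 := (hφ_isom.2 p 1 1).trans (hgk 1 1)
    have e2 := (hφ_isom.2 p Complex.I Complex.I).trans (hgk Complex.I Complex.I)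
    simp only [formH2R] at e1 e2
    simp at e1 e2
    rw [h1, h1, h2, h2, sq, sq, e1, e2]
  · obtain ⟨k, hk, hgk⟩ := hg p
    have e1 := (hφ_isom.2 p 1 Complex.I).trans (hgk 1 Complex.I)
    simp only [formH2R] at e1
    simp at e1
    rw [h1, h1, h2, h2, e1]
  · by_contra hcon
    push Not at hcon
    rw [h2, h2] at hcon
    obtain ⟨k, hk, hgk⟩ := hg p
    have hiso : ∀ v w : ℂ, formH2R (diffAt φ p v) (diffAt φ p w)
        = k * (v * starRingEnd ℂ w).re := fun v w => (hφ_isom.2 p v w).trans (hgk v w)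
    have e1 := hiso 1 1
    have e2 := hiso Complex.I Complex.I
    have e3 := hiso 1 Complex.I
    have n1 := hN.normal p 1
    have n2 := hN.normal p Complex.I
    have n3 : lorentz (φ p).1 (N p).1 = 0 := hN.tangent p
    simp only [formH2R, hcon.1, hcon.2] at e1 e2 e3 n1 n2
    simp at e1 e2 e3 n1 n2
    have htan : ∀ v, lorentz (φ p).1 (diffAt φ p v).1 = 0 := fun v => by
      have := lorentz_diffAt_eq_zero (hd1 p).1 hunit v
      rwa [(hd1 p).2] at this
    have hzero := eq_zero_of_lorentz_orthogonal (hunit p) (htan 1) (htan Complex.I) e3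
      (by rw [e1]; exact hk.ne') (by rw [e2]; exact hk.ne') n3
      (by rw [lorentz_comm]; exact n1) (by rw [lorentz_comm]; exact n2)
    have hu := hN.unit p
    have hlt := hν p
    simp only [formH2R, angle, vertical, hzero] at hu hlt
    simp [lorentz] at hu hlt
    have hl := abs_lt.1 hlt
    nlinarith [mul_pos (by linarith [hl.1] : 0 < 1 + (N p).2)
      (by linarith [hl.2] : 0 < 1 - (N p).2)]
  · filter_upwards [hlap p] with u ⟨hu, l, hl⟩
    refine ⟨l, ?_⟩
    have := planeLaplacian_clm_comp (ContinuousLinearMap.fst ℝ R31 ℝ) hu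
    rw [hl] at this
    exact this
  · filter_upwards [hlap p] with u ⟨hu, l, hl⟩
    have := planeLaplacian_clm_comp (ContinuousLinearMap.snd ℝ R31 ℝ) hu
    rw [hl] at this
    exact this

end Minimal

/-! ### The connection form of a harmonic map into `ℍ²` -/

section GaussForm

/-- Multiplication by `i` on `ℂ`, as a real linear map. -/
def mulI : ℂ →L[ℝ] ℂ := Complex.I • ContinuousLinearMap.id ℝ ℂ

@[simp] theorem mulI_apply (v : ℂ) : mulI v = Complex.I * v := rfl

/-- For a linear map `T` into the tangent plane of `ℍ²` at `x`, with complex structure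
`w ↦ x × w`, the map `v ↦ (x × T v + T (i v)) / 2`: it is the complex linear part of `T`,
turned by a right angle. -/
def gaussForm (x : R31) (T : ℂ →L[ℝ] R31) : ℂ →L[ℝ] R31 :=
  (1 / 2 : ℝ) • (lcrossL x ∘L T + T ∘L mulI)

theorem gaussForm_apply (x : R31) (T : ℂ →L[ℝ] R31) (v : ℂ) :
    gaussForm x T v = (1 / 2 : ℝ) • (lcross x (T v) + T (Complex.I * v)) := rfl

theorem gaussForm_comp (x : R31) (T : ℂ →L[ℝ] R31) {A : ℂ →L[ℝ] ℂ}
    (hA : ∀ v, A (Complex.I * v) = Complex.I * A v) :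
    gaussForm x (T ∘L A) = gaussForm x T ∘L A := by
  ext1 v
  simp [gaussForm_apply, hA]

variable {x : R31} {T : ℂ →L[ℝ] R31}

theorem lcross_lcross_of_unit (hx : lorentz x x = -1) {a : R31} (ha : lorentz x a = 0) :
    lcross x (lcross x a) = -a := by
  rw [lcross_lcross, hx, ha]; simp

theorem lorentz_gaussForm (hT : ∀ v, lorentz x (T v) = 0) (v : ℂ) :
    lorentz x (gaussForm x T v) = 0 := by
  rw [gaussForm_apply, lorentz_smul_right, lorentz_add_right, lorentz_lcross_left, hT]; simp

theorem gaussForm_I_mul (hx : lorentz x x = -1) (hT : ∀ v, lorentz x (T v) = 0) (v : ℂ) :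
    gaussForm x T (Complex.I * v) = lcross x (gaussForm x T v) := by
  have h1 : Complex.I * (Complex.I * v) = -v := by rw [← mul_assoc, Complex.I_mul_I]; ring
  have h2 := (lcrossL x).map_smul (1 / 2 : ℝ) (lcross x (T v) + T (Complex.I * v))
  rw [map_add] at h2
  simp only [lcrossL_apply, lcross_lcross_of_unit hx (hT v)] at h2
  rw [gaussForm_apply, gaussForm_apply, h2, h1, map_neg, add_comm]

theorem gaussForm_eq (hx : lorentz x x = -1) (hT : ∀ v, lorentz x (T v) = 0) (v : ℂ) :
    gaussForm x T v = v.re • gaussForm x T 1 + v.im • lcross x (gaussForm x T 1) := by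
  have h1 : v = v.re • (1 : ℂ) + v.im • (Complex.I * 1) := by simp
  conv_lhs => rw [h1]
  rw [map_add, map_smul, map_smul, gaussForm_I_mul hx hT]

theorem lorentz_lcross_lcross (hx : lorentz x x = -1) {a b : R31} (hb : lorentz x b = 0) :
    lorentz (lcross x a) (lcross x b) = lorentz a b := by
  rw [lorentz_lcross_swap, lcross_lcross_of_unit hx hb]
  simp [lorentz]
  ring

theorem gaussForm_conformal (hx : lorentz x x = -1) (hT : ∀ v, lorentz x (T v) = 0) (v w : ℂ) :
    lorentz (gaussForm x T v) (gaussForm x T w)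
      = lorentz (gaussForm x T 1) (gaussForm x T 1) * (v * starRingEnd ℂ w).re := by
  have h1 := lorentz_gaussForm hT 1
  rw [gaussForm_eq hx hT v, gaussForm_eq hx hT w]
  simp only [lorentz_add_left, lorentz_add_right, lorentz_smul_left, lorentz_smul_right,
    lorentz_lcross_lcross hx h1, lorentz_lcross_right,
    lorentz_comm (lcross x (gaussForm x T 1)) (gaussForm x T 1)]
  simp
  ring

/-- The complex linear part of `T` vanishes only if `T` is antiholomorphic, hence conformal. -/
theorem gaussForm_pos (hx : lorentz x x = -1) (hT : ∀ v, lorentz x (T v) = 0)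
    (hne : lorentz (T 1) (T 1) ≠ lorentz (T Complex.I) (T Complex.I) ∨
      lorentz (T 1) (T Complex.I) ≠ 0) :
    0 < lorentz (gaussForm x T 1) (gaussForm x T 1) := by
  refine lorentz_pos_of_orthogonal hx (lorentz_gaussForm hT 1) fun h0 => ?_
  rw [gaussForm_apply, mul_one, smul_eq_zero] at h0
  have h1 : T Complex.I = -lcross x (T 1) :=
    eq_neg_of_add_eq_zero_right (h0.resolve_left (by norm_num))
  have h2 : lorentz (T Complex.I) (T Complex.I) = lorentz (T 1) (T 1) := by
    have := lorentz_lcross_lcross hx (a := T 1) (hT 1)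
    rw [h1, ← this]
    simp [lorentz]
  have h3 : lorentz (T 1) (T Complex.I) = 0 := by
    have := lorentz_lcross_right x (T 1)
    rw [h1]
    simp only [lorentz, Pi.neg_apply] at this ⊢
    linarith
  rcases hne with h | h
  · exact h h2.symm
  · exact h h3

/-- The commutator term of the connection form of a map into `ℍ²` with differential `T`. -/
theorem lcross_gaussForm (hx : lorentz x x = -1) (hT : ∀ v, lorentz x (T v) = 0) :
    (2 : ℝ) • lcross (gaussForm x T 1) (gaussForm x T Complex.I)
      = lcross (T 1) (T Complex.I)
        - ((1 / 2 : ℝ) * (lorentz (T 1) (T 1) + lorentz (T Complex.I) (T Complex.I))) • x := by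
  have hI : Complex.I * Complex.I = -1 := Complex.I_mul_I
  have h1 : lcross x (lcross (T 1) (T Complex.I)) = 0 := by
    rw [lcross_lcross, hT, hT]; simp
  have h2 := eq_smul_of_lcross_eq_zero hx h1
  have hg1 := lorentz_gaussForm hT 1
  -- both sides are multiples of `x`, as `g (i v) = x × g v`
  have h3 : gaussForm x T Complex.I = lcross x (gaussForm x T 1) := by
    rw [← gaussForm_I_mul hx hT, mul_one]
  have h4 : lcross (gaussForm x T 1) (lcross x (gaussForm x T 1))
      = -(lorentz (gaussForm x T 1) (gaussForm x T 1)) • x := by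
    rw [lcross_lcross, lorentz_comm _ x, hg1]; simp
  have h5 : lorentz (gaussForm x T 1) (gaussForm x T 1) = (1 / 4 : ℝ) *
      (lorentz (T 1) (T 1) + lorentz (T Complex.I) (T Complex.I)
        + 2 * lorentz x (lcross (T 1) (T Complex.I))) := by
    have h6 : lorentz (lcross x (T 1)) (T Complex.I)
        = lorentz x (lcross (T 1) (T Complex.I)) := by
      simp only [lorentz, lcross, Matrix.cons_val]; ring
    rw [gaussForm_apply, mul_one]
    simp only [lorentz_add_left, lorentz_add_right, lorentz_smul_left, lorentz_smul_right,
      lorentz_lcross_lcross hx (hT 1), lorentz_comm (T Complex.I) (lcross x (T 1)), h6]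
    ring
  rw [h3, h4, h5]
  conv_rhs => rw [h2]
  module

end GaussForm

section Flat

variable {η : ℂ → R31} {u : ℂ}

theorem hasFDerivAt_gaussForm (hη : ContDiffAt ℝ 2 η u) :
    ∃ D : ℂ →L[ℝ] ℂ →L[ℝ] R31, HasFDerivAt (fun z => gaussForm (η z) (fderiv ℝ η z)) D u ∧
      ∀ v w, D v w = (1 / 2 : ℝ) • (lcross (fderiv ℝ η u v) (fderiv ℝ η u w)
        + lcross (η u) (fderiv ℝ (fderiv ℝ η) u v w)
        + fderiv ℝ (fderiv ℝ η) u v (Complex.I * w)) := by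
  have h1 := (hη.differentiableAt (by simp)).hasFDerivAt
  have h2 := (ContDiffAt.differentiableAt_fderiv hη).hasFDerivAt
  have h3 := ((((lcrossL.hasFDerivAt (x := η u)).comp u h1).clm_comp h2).add
    (h2.clm_comp (hasFDerivAt_const mulI u))).const_smul (1 / 2 : ℝ)
  refine ⟨_, h3, fun v w => ?_⟩
  simp
  module

/-- The matrix-valued one-form `clifford ∘ gaussForm` of a map `η` into `ℍ²`, in a chart. -/
def planeConnection (η : ℂ → R31) (z : ℂ) : ℂ →L[ℝ] R42 →L[ℝ] R42 :=
  clifford ∘L gaussForm (η z) (fderiv ℝ η z)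

theorem hasFDerivAt_planeConnection {D : ℂ →L[ℝ] ℂ →L[ℝ] R31}
    (hD : HasFDerivAt (fun z => gaussForm (η z) (fderiv ℝ η z)) D u) :
    ∃ D' : ℂ →L[ℝ] ℂ →L[ℝ] R42 →L[ℝ] R42, HasFDerivAt (planeConnection η) D' u ∧
      ∀ v w, D' v w = clifford (D v w) :=
  ⟨_, (hasFDerivAt_const clifford u).clm_comp hD, fun v w => by simp⟩

theorem contDiffAt_planeConnection (hη : ContDiffAt ℝ ∞ η u) :
    ContDiffAt ℝ ∞ (planeConnection η) u := by
  have h1 : ContDiffAt ℝ ∞ (fderiv ℝ η) u := hη.fderiv_right (by norm_cast)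
  have h2 : ContDiffAt ℝ ∞ (fun z => gaussForm (η z) (fderiv ℝ η z)) u :=
    (((lcrossL.contDiff.contDiffAt.comp u hη).clm_comp h1).add
      (h1.clm_comp contDiffAt_const)).const_smul (1 / 2 : ℝ)
  exact contDiffAt_const.clm_comp h2

/-- Two derivatives of the equation `⟨η, η⟩ = -1`. -/
theorem lorentz_fderiv_of_unit (hη : ContDiffAt ℝ 2 η u)
    (hunit : ∀ᶠ z in 𝓝 u, lorentz (η z) (η z) = -1) :
    (∀ v, lorentz (η u) (fderiv ℝ η u v) = 0) ∧
      ∀ v, lorentz (η u) (fderiv ℝ (fderiv ℝ η) u v v)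
        = -lorentz (fderiv ℝ η u v) (fderiv ℝ η u v) := by
  have key : ∀ z, DifferentiableAt ℝ η z → (∀ᶠ y in 𝓝 z, lorentz (η y) (η y) = -1) →
      ∀ v, lorentz (η z) (fderiv ℝ η z v) = 0 := by
    intro z hz hy v
    have h1 : HasFDerivAt (fun y => lorentzL (η y) (η y)) _ z :=
      lorentzL.hasFDerivAt_of_bilinear hz.hasFDerivAt hz.hasFDerivAt
    have h2 : (fun y => lorentzL (η y) (η y)) =ᶠ[𝓝 z] fun _ => (-1 : ℝ) := hy
    have h3 := DFunLike.congr_fun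
      (h1.unique ((hasFDerivAt_const (-1 : ℝ) z).congr_of_eventuallyEq h2)) v
    simp only [add_apply, ContinuousLinearMap.precompR_apply, ContinuousLinearMap.precompL_apply,
      ContinuousLinearMap.compL_apply, ContinuousLinearMap.comp_apply, lorentzL_apply,
      zero_apply] at h3
    rw [lorentz_comm (fderiv ℝ η z v)] at h3
    linarith
  have hdiff : ∀ᶠ z in 𝓝 u, DifferentiableAt ℝ η z :=
    (hη.eventually (by simp)).mono fun z hz => hz.differentiableAt (by simp)
  refine ⟨key u hdiff.self_of_nhds hunit, fun v => ?_⟩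
  have happ : HasFDerivAt (fun z => fderiv ℝ η z v) ((fderiv ℝ (fderiv ℝ η) u).flip v) u := by
    simpa using (ContDiffAt.differentiableAt_fderiv hη).hasFDerivAt.clm_apply
      (hasFDerivAt_const v u)
  have h1 : HasFDerivAt (fun y => lorentzL (η y) (fderiv ℝ η y v)) _ u :=
    lorentzL.hasFDerivAt_of_bilinear hdiff.self_of_nhds.hasFDerivAt happ
  have h2 : (fun y => lorentzL (η y) (fderiv ℝ η y v)) =ᶠ[𝓝 u] fun _ => (0 : ℝ) := by
    filter_upwards [hdiff, hunit.eventually_nhds] with z hz hz'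
    exact key z hz hz' v
  have h3 := DFunLike.congr_fun
    (h1.unique ((hasFDerivAt_const (0 : ℝ) u).congr_of_eventuallyEq h2)) v
  simp only [add_apply, ContinuousLinearMap.precompR_apply, ContinuousLinearMap.precompL_apply,
    ContinuousLinearMap.compL_apply, ContinuousLinearMap.comp_apply, lorentzL_apply,
    ContinuousLinearMap.flip_apply, zero_apply] at h3
  linarith

/-- An integrability condition on `ℂ` need only be checked on `(1, i)`. -/
theorem isFlatAt_of_one_I {𝔸 : Type*} [NormedRing 𝔸] [NormedAlgebra ℝ 𝔸] {A : ℂ → ℂ →L[ℝ] 𝔸}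
    (h : fderiv ℝ A u 1 Complex.I + A u Complex.I * A u 1
      = fderiv ℝ A u Complex.I 1 + A u 1 * A u Complex.I) : IsFlatAt A u := by
  intro v w
  have hb : ∀ v : ℂ, v = v.re • (1 : ℂ) + v.im • Complex.I := fun v => by simp
  generalize fderiv ℝ A u = D at h ⊢
  rw [hb v, hb w]
  simp only [map_add, map_smul, add_apply, smul_apply, mul_add, add_mul, smul_mul_assoc,
    mul_smul_comm]
  linear_combination (norm := module) (v.re * w.im - v.im * w.re) • h

/-- The connection form of a harmonic map into `ℍ²` is flat. -/
theorem isFlatAt_planeConnection (hη : ContDiffAt ℝ 2 η u)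
    (hunit : ∀ᶠ z in 𝓝 u, lorentz (η z) (η z) = -1) {l : ℝ}
    (hharm : planeLaplacian η u = l • η u) : IsFlatAt (planeConnection η) u := by
  obtain ⟨D, hD, hDv⟩ := hasFDerivAt_gaussForm hη
  have hx := hunit.self_of_nhds
  obtain ⟨hT, hT2⟩ := lorentz_fderiv_of_unit hη hunit
  have hsymm : fderiv ℝ (fderiv ℝ η) u Complex.I 1 = fderiv ℝ (fderiv ℝ η) u 1 Complex.I :=
    hη.isSymmSndFDerivAt (by simp) _ _
  have hl : l = lorentz (fderiv ℝ η u 1) (fderiv ℝ η u 1)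
      + lorentz (fderiv ℝ η u Complex.I) (fderiv ℝ η u Complex.I) := by
    have h1 : lorentz (η u) (planeLaplacian η u) = -l := by
      rw [hharm, lorentz_smul_right, hx, mul_neg_one]
    rw [planeLaplacian, lorentz_add_right, hT2, hT2] at h1
    linarith
  have hcross := lcross_gaussForm hx hT
  rw [← hl] at hcross
  have hvec : D 1 Complex.I - D Complex.I 1
      = (2 : ℝ) • lcross (gaussForm (η u) (fderiv ℝ η u) 1)
          (gaussForm (η u) (fderiv ℝ η u) Complex.I) := by
    have hP : fderiv ℝ (fderiv ℝ η) u Complex.I Complex.I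
        = l • η u - fderiv ℝ (fderiv ℝ η) u 1 1 := by
      rw [← hharm, planeLaplacian]; abel
    rw [hcross, hDv, hDv, mul_one, Complex.I_mul_I, map_neg, hsymm, hP,
      lcross_comm (fderiv ℝ η u Complex.I)]
    module
  apply isFlatAt_of_one_I
  obtain ⟨D', hD', hDv'⟩ := hasFDerivAt_planeConnection hD
  rw [hD'.fderiv, hDv', hDv']
  refine ContinuousLinearMap.ext fun y => ?_
  simp only [planeConnection, ContinuousLinearMap.comp_apply, add_apply, mul_apply_eq_comp,
    clifford_clifford]
  have h1 := congrArg (fun m => clifford m y) hvec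
  simp only [map_sub, map_smul, sub_apply, smul_apply] at h1
  rw [lcross_comm (gaussForm (η u) (fderiv ℝ η u) Complex.I),
    lorentz_comm (gaussForm (η u) (fderiv ℝ η u) Complex.I), map_neg, neg_apply]
  linear_combination (norm := module) h1

end Flat

/-! ### The maximal immersion with given Gauss map -/

section Immersion

variable {S : Type*} [TopologicalSpace S] [ChartedSpace ℂ S]

/-- The matrix-valued one-form `clifford ∘ gaussForm` of a map `η` into `ℍ²`. -/
def surfaceConnection (η : S → R31) (q : S) : ℂ →L[ℝ] R42 →L[ℝ] R42 :=
  clifford ∘L gaussForm (η q) (diffAt η q)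

variable {η : S → R31} {h : S → ℝ}

theorem IsMinimalPair.lorentz_diffAt (hp : IsMinimalPair η h) (p : S) (v : ℂ) :
    lorentz (η p) (diffAt η p v) = 0 :=
  lorentz_diffAt_eq_zero (hp.smooth_fst.contMDiffAt.mdifferentiableAt (by simp)) hp.unit v

/-- An orthonormal basis for a conformal product on `ℂ` is `(a, ± i a)`. -/
theorem eq_mul_I_or_of_orthonormal {c : ℝ} {a b : ℂ} (ha : c * (a * starRingEnd ℂ a).re = 1)
    (hb : c * (b * starRingEnd ℂ b).re = 1) (hab : c * (a * starRingEnd ℂ b).re = 0) :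
    b = a * Complex.I ∨ b = -(a * Complex.I) := by
  have hc : c ≠ 0 := by
    rintro rfl
    simp at ha
  simp only [Complex.mul_re, Complex.conj_re, Complex.conj_im] at ha hb hab
  have hab' : a.re * b.re + a.im * b.im = 0 := by
    have := (mul_eq_zero.1 hab).resolve_left hc
    linarith
  have hr : a.re * a.re + a.im * a.im = b.re * b.re + b.im * b.im := by
    have := mul_left_cancel₀ hc (ha.trans hb.symm)
    linarith
  -- `b` is at distance zero from `a i` or from `-a i`, according to the sign of `det (a, b)`
  have hdet : (a.re * b.im - a.im * b.re - (a.re * a.re + a.im * a.im))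
      * (a.re * b.im - a.im * b.re + (a.re * a.re + a.im * a.im)) = 0 := by
    linear_combination (-(a.re * b.re + a.im * b.im)) * hab'
      - (a.re * a.re + a.im * a.im) * hr
  rcases mul_eq_zero.1 hdet with hd | hd
  · left
    have hs : (b.re + a.im) ^ 2 + (b.im - a.re) ^ 2 = 0 := by linarith
    have h1 : b.re + a.im = 0 := by nlinarith [sq_nonneg (b.re + a.im), sq_nonneg (b.im - a.re)]
    have h2 : b.im - a.re = 0 := by nlinarith [sq_nonneg (b.re + a.im), sq_nonneg (b.im - a.re)]
    apply Complex.ext <;> simp <;> linarith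
  · right
    have hs : (b.re - a.im) ^ 2 + (b.im + a.re) ^ 2 = 0 := by linarith
    have h1 : b.re - a.im = 0 := by nlinarith [sq_nonneg (b.re - a.im), sq_nonneg (b.im + a.re)]
    have h2 : b.im + a.re = 0 := by nlinarith [sq_nonneg (b.re - a.im), sq_nonneg (b.im + a.re)]
    apply Complex.ext <;> simp <;> linarith

/-- `ψ` is a map into anti-de Sitter space that is parallel for the connection form of `η`. -/
structure IsParallelSection (η : S → R31) (ψ : S → R42) : Prop where
  smooth : ContMDiff 𝓘(ℝ, ℂ) 𝓘(ℝ, R42) ∞ ψ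
  unit : ∀ q, form42 (ψ q) (ψ q) = -1
  diffAt_eq : ∀ q v, diffAt ψ q v = clifford (gaussForm (η q) (diffAt η q) v) (ψ q)

theorem IsMinimalPair.gaussForm_pos (hp : IsMinimalPair η h) (p : S) :
    0 < lorentz (gaussForm (η p) (diffAt η p) 1) (gaussForm (η p) (diffAt η p) 1) := by
  refine AdSGauss.gaussForm_pos (hp.unit p) (hp.lorentz_diffAt p) ?_
  by_contra hcon
  push Not at hcon
  have h1 := hp.norm_eq p
  have h2 := hp.orthogonal p
  rw [hcon.1] at h1
  rw [hcon.2, zero_add] at h2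
  rcases hp.regular p with h3 | h3 <;> rcases mul_eq_zero.1 h2 with h4 | h4 <;>
    simp_all

theorem IsParallelSection.form42_diffAt {ψ : S → R42} (hψ : IsParallelSection η ψ)
    (hp : IsMinimalPair η h) (p : S) (v w : ℂ) : form42 (diffAt ψ p v) (diffAt ψ p w)
      = lorentz (gaussForm (η p) (diffAt η p) 1) (gaussForm (η p) (diffAt η p) 1)
        * (v * starRingEnd ℂ w).re := by
  rw [hψ.diffAt_eq, hψ.diffAt_eq, form42_clifford_clifford, hψ.unit,
    gaussForm_conformal (hp.unit p) (hp.lorentz_diffAt p)]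
  ring

variable [IsManifold 𝓘(ℂ) ω S]

theorem surfaceConnection_eq_chart (hη : ContMDiff 𝓘(ℝ, ℂ) 𝓘(ℝ, R31) ∞ η) {p q : S}
    (hq : q ∈ (chartAt ℂ p).source) :
    surfaceConnection η q = planeConnection (η ∘ (chartAt ℂ p).symm) (chartAt ℂ p q) ∘L
      diffAt (chartAt ℂ p) q := by
  have : IsManifold 𝓘(ℝ, ℂ) ∞ S := isManifold_real
  rw [surfaceConnection, planeConnection, ContinuousLinearMap.comp_assoc,
    diffAt_eq_fderiv_comp_diffAt_chart hq (hη.contMDiffAt.mdifferentiableAt (by simp)),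
    gaussForm_comp _ _ (diffAt_chart_I_mul hq), Function.comp_apply, (chartAt ℂ p).left_inv hq]

theorem contMDiff_of_parallel {𝔸 : Type*} [NormedRing 𝔸] [NormedAlgebra ℝ 𝔸]
    {α : S → ℂ →L[ℝ] 𝔸} (hα : IsFlatConnection α) {Y : S → 𝔸} (hY : ∀ q, IsParallelAt α Y q) :
    ContMDiff 𝓘(ℝ, ℂ) 𝓘(ℝ, 𝔸) ∞ Y := by
  intro p
  obtain ⟨A, hA, -, hαA⟩ := hα p
  exact contMDiffAt_of_contDiffAt_comp_chart_symm (contDiffAt_of_parallel hA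
    (eventually_hasFDerivAt_of_parallel hαA (Eventually.of_forall hY)))

theorem IsMinimalPair.isFlatConnection (hp : IsMinimalPair η h) :
    IsFlatConnection (surfaceConnection η) := by
  intro p
  refine ⟨planeConnection (η ∘ (chartAt ℂ p).symm), contDiffAt_planeConnection
    (contDiffAt_comp_chart_symm hp.smooth_fst (mem_chart_target ℂ p)), ?_, ?_⟩
  · filter_upwards [(chartAt ℂ p).open_target.mem_nhds (mem_chart_target ℂ p),
      hp.harmonic_fst p] with u hu ⟨l, hl⟩
    exact isFlatAt_planeConnection
      ((contDiffAt_comp_chart_symm hp.smooth_fst hu).of_le (by norm_cast))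
      (Eventually.of_forall fun z => hp.unit _) hl
  · filter_upwards [chart_source_mem_nhds ℂ p] with q hq
    exact surfaceConnection_eq_chart hp.smooth_fst hq

theorem IsMinimalPair.exists_parallelSection [SimplyConnectedSpace S] (hp : IsMinimalPair η h) :
    ∃ ψ : S → R42, IsParallelSection η ψ := by
  obtain ⟨p₀⟩ : Nonempty S := inferInstance
  obtain ⟨Y, hY0, hY⟩ := hp.isFlatConnection.exists_global p₀
  let L : (R42 →L[ℝ] R42) →L[ℝ] R42 := ContinuousLinearMap.apply ℝ R42 (e 2)
  have hsm : ContMDiff 𝓘(ℝ, ℂ) 𝓘(ℝ, R42) ∞ fun q => L (Y q) :=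
    L.contDiff.contMDiff.comp (contMDiff_of_parallel hp.isFlatConnection fun q => (hY q).1)
  have hd : ∀ q v, diffAt (fun q => L (Y q)) q v
      = clifford (gaussForm (η q) (diffAt η q) v) (L (Y q)) := fun q v => by
    rw [(diffAt_comp (hY q).1.1 L.hasFDerivAt).2, (hY q).1.2]
    rfl
  have hmd : ∀ q, MDifferentiableAt 𝓘(ℝ, ℂ) 𝓘(ℝ, R42) (fun q => L (Y q)) q :=
    fun q => hsm.contMDiffAt.mdifferentiableAt (by simp)
  refine ⟨fun q => L (Y q), hsm, fun q => ?_, hd⟩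
  have hconst := eq_of_diffAt_eq_zero (f := fun q => form42L (L (Y q)) (L (Y q)))
    (fun q => (diffAt_bilinear form42L (hmd q) (hmd q)).1) (fun q v => by
      rw [(diffAt_bilinear form42L (hmd q) (hmd q)).2, hd, form42L_apply, form42L_apply,
        form42_comm (clifford _ _), form42_clifford_self, add_zero]) q p₀
  refine hconst.trans ?_
  simp only [hY0, form42L_apply]
  simp [L, form42, e]

/-- The second derivatives of a parallel section in a chart. -/
theorem IsParallelSection.exists_secondDiffAt_eq {ψ : S → R42} (hψ : IsParallelSection η ψ)
    (hη : ContMDiff 𝓘(ℝ, ℂ) 𝓘(ℝ, R31) ∞ η) (p : S) :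
    ∃ D : ℂ →L[ℝ] ℂ →L[ℝ] R31,
      (∀ v w, D v w = (1 / 2 : ℝ) • (lcross (diffAt η p v) (diffAt η p w)
        + lcross (η p) (secondDiffAt η p v w) + secondDiffAt η p v (Complex.I * w))) ∧
      ∀ v w, secondDiffAt ψ p v w = clifford (D v w) (ψ p)
        + clifford (gaussForm (η p) (diffAt η p) w)
            (clifford (gaussForm (η p) (diffAt η p) v) (ψ p)) := by
  have : IsManifold 𝓘(ℝ, ℂ) ∞ S := isManifold_real
  have hmd : ∀ q, MDifferentiableAt 𝓘(ℝ, ℂ) 𝓘(ℝ, R42) ψ q :=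
    fun q => hψ.smooth.contMDiffAt.mdifferentiableAt (by simp)
  have hηd : MDifferentiableAt 𝓘(ℝ, ℂ) 𝓘(ℝ, R31) η p :=
    hη.contMDiffAt.mdifferentiableAt (by simp)
  have htgt := mem_chart_target ℂ p
  have hleft : (chartAt ℂ p).symm (chartAt ℂ p p) = p :=
    (chartAt ℂ p).left_inv (mem_chart_source ℂ p)
  obtain ⟨D, hD, hDv⟩ := hasFDerivAt_gaussForm
    ((contDiffAt_comp_chart_symm hη htgt).of_le (by norm_cast))
  refine ⟨D, fun v w => ?_, fun v w => ?_⟩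
  · rw [hDv, ← diffAt_eq_fderiv hηd]
    simp [secondDiffAt, hleft]
  obtain ⟨D', hD', hDv'⟩ := hasFDerivAt_planeConnection hD
  have hΨ : ContDiffAt ℝ 2 (ψ ∘ (chartAt ℂ p).symm) (chartAt ℂ p p) :=
    (contDiffAt_comp_chart_symm hψ.smooth htgt).of_le (by norm_cast)
  have hΨd := (hΨ.differentiableAt (by simp)).hasFDerivAt
  have h1 : (fun z => fderiv ℝ (ψ ∘ (chartAt ℂ p).symm) z w) =ᶠ[𝓝 (chartAt ℂ p p)]
      fun z => planeConnection (η ∘ (chartAt ℂ p).symm) z w ((ψ ∘ (chartAt ℂ p).symm) z) := by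
    filter_upwards [(chartAt ℂ p).open_target.mem_nhds htgt] with z hz
    have hq := (chartAt ℂ p).map_target hz
    obtain ⟨a, ha, hmul⟩ := exists_diffAt_chart_eq_mul hq
    have e1 := DFunLike.congr_fun (diffAt_eq_fderiv_comp_diffAt_chart hq (hmd _)) (a⁻¹ * w)
    have e2 := DFunLike.congr_fun (surfaceConnection_eq_chart hη hq) (a⁻¹ * w)
    simp only [ContinuousLinearMap.comp_apply, hmul, mul_inv_cancel_left₀ ha,
      (chartAt ℂ p).right_inv hz] at e1 e2
    rw [← e1, ← e2, hψ.diffAt_eq]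
    rfl
  have h2 : HasFDerivAt (fun z => fderiv ℝ (ψ ∘ (chartAt ℂ p).symm) z w)
      ((fderiv ℝ (fderiv ℝ (ψ ∘ (chartAt ℂ p).symm)) (chartAt ℂ p p)).flip w)
      (chartAt ℂ p p) := by
    simpa using (ContDiffAt.differentiableAt_fderiv hΨ).hasFDerivAt.clm_apply
      (hasFDerivAt_const w _)
  have h3 := (hD'.clm_apply (hasFDerivAt_const w _)).clm_apply hΨd
  have h4 := DFunLike.congr_fun (h2.unique (h3.congr_of_eventuallyEq h1)) v
  rw [← diffAt_eq_fderiv (hmd p)] at h4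
  simp only [ContinuousLinearMap.flip_apply, add_apply, ContinuousLinearMap.comp_apply,
    zero_apply, map_zero, zero_add, hDv', Function.comp_apply, hleft, planeConnection,
    ← diffAt_eq_fderiv hηd, hψ.diffAt_eq] at h4
  rw [secondDiffAt, h4, add_comm]

/-- In the trace of the second fundamental form of `ψ`, the terms quadratic in `ω` are multiples of
`ψ`, hence orthogonal to anti-de Sitter space, and the linear term is `η × Δη / 2 = 0`. -/
theorem IsParallelSection.isConformalMaximalImmersion {ψ : S → R42}
    (hψ : IsParallelSection η ψ) (hp : IsMinimalPair η h) : IsConformalMaximalImmersion ψ := by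
  refine ⟨hψ.unit, ⟨fun p v w => form42 (diffAt ψ p v) (diffAt ψ p w), fun p =>
    ⟨_, hp.gaussForm_pos p, hψ.form42_diffAt hp p⟩, hψ.smooth, fun p v w => rfl⟩, ?_⟩
  intro p ξ hξ _ e₁ e₂ h1 h2 h12
  rw [hψ.form42_diffAt hp] at h1 h2 h12
  obtain ⟨D, hD, hψ2⟩ := hψ.exists_secondDiffAt_eq hp.smooth_fst p
  have hterm : ∀ v, form42 (secondDiffAt ψ p v v) ξ = form42 (clifford (D v v) (ψ p)) ξ := by
    intro v
    have : form42 (ψ p) ξ = 0 := hξ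
    rw [hψ2, clifford_clifford, lcross_self, map_zero, zero_apply, add_zero, ← form42L_apply,
      map_add, map_smul, add_apply, smul_apply, form42L_apply, form42L_apply, this]
    simp
  have htrace : D e₁ e₁ + D e₂ e₂ = 0 := by
    have h3 : D e₂ e₂ = D (e₁ * Complex.I) (e₁ * Complex.I) := by
      rcases eq_mul_I_or_of_orthonormal h1 h2 h12 with rfl | rfl <;> simp
    obtain ⟨l, hl⟩ := (hp.harmonic_fst p).self_of_nhds
    have hl' : secondDiffAt η p Complex.I Complex.I = l • η p - secondDiffAt η p 1 1 := by
      simp only [planeLaplacian, Function.comp_apply,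
        (chartAt ℂ p).left_inv (mem_chart_source ℂ p)] at hl
      rw [← hl]
      exact (add_sub_cancel_left _ _).symm
    have hsymm : secondDiffAt η p Complex.I 1 = secondDiffAt η p 1 Complex.I :=
      ((contDiffAt_comp_chart_symm hp.smooth_fst (mem_chart_target ℂ p)).of_le
        (m := 2) (by norm_cast)).isSymmSndFDerivAt (by simp) _ _
    have hneg : secondDiffAt η p Complex.I (-1) = -secondDiffAt η p Complex.I 1 :=
      map_neg _ _
    have hcross : lcross (η p) (l • η p - secondDiffAt η p 1 1)
        = -lcross (η p) (secondDiffAt η p 1 1) := by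
      rw [← lcrossL_apply, map_sub, map_smul, lcrossL_apply, lcross_self, smul_zero, zero_sub]
      rfl
    rw [h3, trace_mul_eq, hD, hD, mul_one, Complex.I_mul_I, hneg, hsymm, hl', hcross, lcross_self,
      lcross_self]
    module
  rw [hterm, hterm, ← form42L_apply, ← form42L_apply, ← add_apply, ← map_add, ← add_apply,
    ← map_add, htrace]
  simp

end Immersion

/-! ### The normal, the Hopf differential and the Gauss map of the immersion -/

section Normal

variable {S : Type*} [TopologicalSpace S] [ChartedSpace ℂ S]
variable {η : S → R31} {h : S → ℝ} {ψ : S → R42}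

theorem IsParallelSection.isOrientedNormal (hψ : IsParallelSection η ψ)
    (hp : IsMinimalPair η h) : IsOrientedNormal ψ (fun q => clifford (η q) (ψ q)) := by
  refine ⟨?_, fun p => ?_, fun p => form42_clifford_self _ _, fun p v => ?_, fun p => ?_⟩
  · exact clifford.isBoundedBilinearMap.contDiff.contMDiff.comp
      (hp.smooth_fst.prodMk_space hψ.smooth)
  · rw [form42_clifford_clifford, hψ.unit, hp.unit]; norm_num
  · rw [hψ.diffAt_eq, form42_clifford_clifford, lorentz_gaussForm (hp.lorentz_diffAt p)]; simp
  · have h1 := hp.gaussForm_pos p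
    have hI := gaussForm_I_mul (hp.unit p) (hp.lorentz_diffAt p) 1
    rw [mul_one] at hI
    rw [hψ.diffAt_eq, hψ.diffAt_eq, det_clifford, hψ.unit, hI, lcross_lcross,
      lorentz_comm (gaussForm (η p) (diffAt η p) 1) (η p),
      lorentz_gaussForm (hp.lorentz_diffAt p), zero_smul, zero_sub,
      ← neg_smul, lorentz_smul_left, hp.unit]
    linarith

theorem IsParallelSection.form42_diffAt_normal (hψ : IsParallelSection η ψ)
    (hp : IsMinimalPair η h) (p : S) (v w : ℂ) :
    form42 (diffAt ψ p v) (diffAt (fun q => clifford (η q) (ψ q)) p w)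
      = lorentz (gaussForm (η p) (diffAt η p) v) (diffAt η p w)
        + lorentz (gaussForm (η p) (diffAt η p) v)
          (gaussForm (η p) (diffAt η p) (Complex.I * w)) := by
  rw [(diffAt_bilinear clifford (hp.smooth_fst.contMDiffAt.mdifferentiableAt (by simp))
    (hψ.smooth.contMDiffAt.mdifferentiableAt (by simp))).2, hψ.diffAt_eq, hψ.diffAt_eq,
    clifford_clifford, lorentz_gaussForm (hp.lorentz_diffAt p), zero_smul, zero_add,
    ← add_apply, ← map_add, form42_clifford_clifford, hψ.unit,
    gaussForm_I_mul (hp.unit p) (hp.lorentz_diffAt p), lorentz_add_right]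
  ring

/-- The Hopf differential of `ψ` is `-(i / 8) (h_x - i h_y)² dw²`: as `dN = (dη + η × ω) · ψ`, it is
the Hopf differential of `η` up to a constant factor. -/
theorem IsParallelSection.hopf_eq (hψ : IsParallelSection η ψ) (hp : IsMinimalPair η h) (p : S) :
    hopf ψ (fun q => clifford (η q) (ψ q)) p
      = -(Complex.I / 8) * (diffAt h p 1 - Complex.I * diffAt h p Complex.I) ^ 2 := by
  have hx := hp.unit p
  have hT := hp.lorentz_diffAt p
  have h11 := lorentz_lcross_right (η p) (diffAt η p 1)
  have hII := lorentz_lcross_right (η p) (diffAt η p Complex.I)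
  have hswap := lorentz_lcross_swap (η p) (diffAt η p Complex.I) (diffAt η p 1)
  have hn := hp.norm_eq p
  have ho := hp.orthogonal p
  have e1 : lorentz (gaussForm (η p) (diffAt η p) 1) (diffAt η p 1)
      = 1 / 2 * lorentz (diffAt η p 1) (diffAt η p Complex.I) := by
    rw [gaussForm_apply, lorentz_smul_left, lorentz_add_left, lorentz_comm (lcross _ _), h11,
      mul_one, zero_add, lorentz_comm]
  have e2 : lorentz (gaussForm (η p) (diffAt η p) Complex.I) (diffAt η p Complex.I)
      = -(1 / 2 * lorentz (diffAt η p 1) (diffAt η p Complex.I)) := by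
    rw [gaussForm_apply, lorentz_smul_left, lorentz_add_left, lorentz_comm (lcross _ _), hII,
      Complex.I_mul_I, map_neg, ← neg_one_smul ℝ (diffAt η p 1), lorentz_smul_left]
    ring
  have e3 : lorentz (gaussForm (η p) (diffAt η p) 1) (diffAt η p Complex.I)
        + lorentz (gaussForm (η p) (diffAt η p) Complex.I) (diffAt η p 1)
      = 1 / 2 * (lorentz (diffAt η p Complex.I) (diffAt η p Complex.I)
        - lorentz (diffAt η p 1) (diffAt η p 1)) := by
    rw [gaussForm_apply, gaussForm_apply, lorentz_smul_left, lorentz_smul_left, lorentz_add_left,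
      lorentz_add_left, mul_one, Complex.I_mul_I, map_neg, ← neg_one_smul ℝ (diffAt η p 1),
      lorentz_smul_left, hswap, lorentz_comm (lcross _ _)]
    ring
  have r1 : form42 (diffAt ψ p 1) (diffAt (fun q => clifford (η q) (ψ q)) p 1)
      - form42 (diffAt ψ p Complex.I) (diffAt (fun q => clifford (η q) (ψ q)) p Complex.I)
      = -(diffAt h p 1 * diffAt h p Complex.I) := by
    rw [hψ.form42_diffAt_normal hp, hψ.form42_diffAt_normal hp, e1, e2,
      gaussForm_conformal hx hT 1 (Complex.I * 1),
      gaussForm_conformal hx hT Complex.I (Complex.I * Complex.I)]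
    simp
    linarith
  have r2 : form42 (diffAt ψ p 1) (diffAt (fun q => clifford (η q) (ψ q)) p Complex.I)
      + form42 (diffAt ψ p Complex.I) (diffAt (fun q => clifford (η q) (ψ q)) p 1)
      = 1 / 2 * (diffAt h p 1 ^ 2 - diffAt h p Complex.I ^ 2) := by
    rw [hψ.form42_diffAt_normal hp, hψ.form42_diffAt_normal hp,
      gaussForm_conformal hx hT 1 (Complex.I * Complex.I),
      gaussForm_conformal hx hT Complex.I (Complex.I * 1)]
    simp
    linarith
  rw [hopf, r1, r2]
  push_cast
  linear_combination (-(1 / 8 : ℂ) * Complex.I * (diffAt h p Complex.I : ℂ) ^ 2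
    + 1 / 4 * (diffAt h p 1 : ℂ) * (diffAt h p Complex.I : ℂ)) * (-Complex.I_sq)

theorem IsParallelSection.gaussMap_eq (hψ : IsParallelSection η ψ) (hp : IsMinimalPair η h)
    (p : S) : gaussMap 1 ψ (fun q => clifford (η q) (ψ q)) p = toBiv 1 (η p) := by
  have hI := gaussForm_I_mul (hp.unit p) (hp.lorentz_diffAt p) 1
  rw [mul_one] at hI
  rw [gaussMap, hψ.form42_diffAt hp, hψ.diffAt_eq, hψ.diffAt_eq, hI]
  simpa using gauss_clifford (lorentz_gaussForm (hp.lorentz_diffAt p) 1)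
    (hp.gaussForm_pos p).ne' (hψ.unit p)

end Normal

/-! ### The holomorphic function with imaginary part half the height -/

section Height

variable {S : Type*} [TopologicalSpace S] [ChartedSpace ℂ S] [IsManifold 𝓘(ℂ) ω S]

/-- A function whose real differential commutes with `i` is holomorphic. -/
theorem complexDiffAt_eq_of_diffAt_I_mul {z : S → ℂ} {p : S}
    (hz : MDifferentiableAt 𝓘(ℝ, ℂ) 𝓘(ℝ, ℂ) z p)
    (hI : ∀ v, diffAt z p (Complex.I * v) = Complex.I * diffAt z p v) :
    MDifferentiableAt 𝓘(ℂ) 𝓘(ℂ) z p ∧ complexDiffAt z p 1 = diffAt z p 1 ∧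
      ∀ v, diffAt z p v = diffAt z p 1 * v := by
  have hmul : ∀ v, diffAt z p v = diffAt z p 1 * v := fun v => by
    have h1 : v = v.re • (1 : ℂ) + v.im • (Complex.I * 1) := by simp
    conv_lhs => rw [h1]
    rw [map_add, map_smul, map_smul, hI]
    conv_rhs => rw [← Complex.re_add_im v]
    simp only [Complex.real_smul]
    ring
  have : IsManifold 𝓘(ℝ, ℂ) ∞ S := isManifold_real
  have hd := differentiableAt_comp_chart_symm (mem_chart_source ℂ p) hz
  have h1 : HasFDerivAt (𝕜 := ℂ) (z ∘ (chartAt ℂ p).symm)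
      (diffAt z p 1 • ContinuousLinearMap.id ℂ ℂ) (chartAt ℂ p p) := by
    refine hasFDerivAt_of_restrictScalars ℝ hd.hasFDerivAt ?_
    rw [← diffAt_eq_fderiv hz]
    ext1 v
    rw [hmul v]
    simp
  have h2 : HasMFDerivAt 𝓘(ℂ) 𝓘(ℂ) z p (diffAt z p 1 • ContinuousLinearMap.id ℂ ℂ) :=
    ⟨hz.continuousAt, h1.hasFDerivWithinAt⟩
  refine ⟨h2.mdifferentiableAt, ?_, hmul⟩
  rw [complexDiffAt, h2.mfderiv]
  exact mul_one _

/-- The conjugate differential of a harmonic function is closed. -/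
theorem IsMinimalPair.isFlatConnection_conjugate {η : S → R31} {h : S → ℝ}
    (hp : IsMinimalPair η h) : IsFlatConnection fun q => diffAt h q ∘L mulI := by
  have : IsManifold 𝓘(ℝ, ℂ) ∞ S := isManifold_real
  intro p
  have hsm : ∀ u ∈ (chartAt ℂ p).target, ContDiffAt ℝ ∞ (h ∘ (chartAt ℂ p).symm) u :=
    fun u hu => contDiffAt_comp_chart_symm hp.smooth_snd hu
  refine ⟨fun z => fderiv ℝ (h ∘ (chartAt ℂ p).symm) z ∘L mulI, ?_, ?_, ?_⟩
  · exact ((hsm _ (mem_chart_target ℂ p)).fderiv_right (by norm_cast)).clm_comp contDiffAt_const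
  · filter_upwards [(chartAt ℂ p).open_target.mem_nhds (mem_chart_target ℂ p),
      hp.harmonic_snd p] with u hu hharm
    have hd := (ContDiffAt.differentiableAt_fderiv ((hsm u hu).of_le (by norm_cast))).hasFDerivAt
    apply isFlatAt_of_one_I
    rw [(hd.clm_comp (hasFDerivAt_const mulI u)).fderiv, mul_comm (_ : ℝ)]
    rw [planeLaplacian] at hharm
    simp
    linarith
  · filter_upwards [chart_source_mem_nhds ℂ p] with q hq
    ext1 v
    rw [diffAt_eq_fderiv_comp_diffAt_chart hq
      (hp.smooth_snd.contMDiffAt.mdifferentiableAt (by simp))]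
    simp [diffAt_chart_I_mul hq]

theorem IsMinimalPair.exists_conjugate [SimplyConnectedSpace S] {η : S → R31} {h : S → ℝ}
    (hp : IsMinimalPair η h) : ∃ k : S → ℝ, ContMDiff 𝓘(ℝ, ℂ) 𝓘(ℝ, ℝ) ∞ k ∧
      ∀ p v, diffAt k p v = diffAt h p (Complex.I * v) := by
  obtain ⟨p₀⟩ : Nonempty S := inferInstance
  -- a nowhere vanishing solution of `dY = (dh ∘ i) Y` has logarithmic derivative `dh ∘ i`
  obtain ⟨Y, -, hY⟩ := hp.isFlatConnection_conjugate.exists_global p₀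
  refine ⟨fun q => Real.log (Y q), fun q => ?_, fun q v => ?_⟩
  · exact (Real.contDiffAt_log.2 (hY q).2.ne_zero).contMDiffAt.comp q
      (contMDiff_of_parallel hp.isFlatConnection_conjugate (fun q => (hY q).1) q)
  · rw [(diffAt_comp (hY q).1.1 (Real.hasDerivAt_log (hY q).2.ne_zero).hasFDerivAt).2,
      (hY q).1.2]
    have := (hY q).2.ne_zero
    simp
    field_simp

/-- There is a holomorphic function with imaginary part `h / 2`. -/
theorem IsMinimalPair.exists_holomorphic [SimplyConnectedSpace S] {η : S → R31} {h : S → ℝ}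
    (hp : IsMinimalPair η h) : ∃ z : S → ℂ, ContMDiff 𝓘(ℝ, ℂ) 𝓘(ℝ, ℂ) ∞ z ∧
      MDifferentiable 𝓘(ℂ) 𝓘(ℂ) z ∧ (∀ p, 2 * (z p).im = h p) ∧
      (∀ p, complexDiffAt z p 1 = 1 / 2 * (diffAt h p Complex.I + Complex.I * diffAt h p 1)) ∧
      ∀ p v, diffAt z p v = complexDiffAt z p 1 * v := by
  obtain ⟨k, hk, hdk⟩ := hp.exists_conjugate
  let L : ℝ × ℝ →L[ℝ] ℂ := (1 / 2 : ℝ) • (Complex.equivRealProdCLM.symm : ℝ × ℝ →L[ℝ] ℂ)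
  have hL : ∀ a b : ℝ, L (a, b) = 1 / 2 * (a + Complex.I * b) := fun a b => by
    apply Complex.ext <;> simp [L]
  have hsm : ContMDiff 𝓘(ℝ, ℂ) 𝓘(ℝ, ℂ) ∞ fun q => L (k q, h q) :=
    L.contDiff.contMDiff.comp (hk.prodMk_space hp.smooth_snd)
  have hd : ∀ p v, diffAt (fun q => L (k q, h q)) p v
      = 1 / 2 * (diffAt h p (Complex.I * v) + Complex.I * diffAt h p v) := fun p v => by
    have hk1 := (hk.contMDiffAt (x := p)).mdifferentiableAt (by simp)
    have hh1 := (hp.smooth_snd.contMDiffAt (x := p)).mdifferentiableAt (by simp)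
    have h1 : HasMFDerivAt 𝓘(ℝ, ℂ) 𝓘(ℝ, ℝ × ℝ) (fun q => (k q, h q)) p
        ((diffAt k p).prod (diffAt h p)) :=
      ⟨hk1.hasMFDerivAt.1.prodMk hh1.hasMFDerivAt.1, hk1.hasMFDerivAt.2.prodMk hh1.hasMFDerivAt.2⟩
    rw [(diffAt_comp h1.mdifferentiableAt L.hasFDerivAt).2, diffAt, h1.mfderiv]
    change L (diffAt k p v, diffAt h p v) = _
    rw [hL, hdk]
  have hI : ∀ p v, diffAt (fun q => L (k q, h q)) p (Complex.I * v)
      = Complex.I * diffAt (fun q => L (k q, h q)) p v := fun p v => by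
    have h1 : Complex.I * (Complex.I * v) = -v := by rw [← mul_assoc, Complex.I_mul_I]; ring
    rw [hd, hd, h1, map_neg]
    push_cast
    linear_combination (-(1 / 2 : ℂ) * diffAt h p v) * Complex.I_sq
  have key := fun p => complexDiffAt_eq_of_diffAt_I_mul (p := p)
    (hsm.contMDiffAt.mdifferentiableAt (by simp)) (hI p)
  refine ⟨fun q => L (k q, h q), hsm, fun p => (key p).1, fun p => ?_, fun p => ?_, fun p v => ?_⟩
  · change 2 * (L (k p, h p)).im = h p
    rw [hL]; simp
  · rw [(key p).2.1, hd, mul_one]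
  · rw [(key p).2.1, (key p).2.2]

end Height

/-! ### The hyperbolic cylinder -/

section Cylinder

theorem cylinder_zero (z : ℂ) : cylinder 0 z = (1 / √2) • ![Real.sinh (z.re + z.im),
    Real.sinh (z.im - z.re), Real.cosh (z.re + z.im), Real.cosh (z.im - z.re)] := by
  simp [cylinder]

/-- The oriented unit normal of the hyperbolic cylinder `ψ₀`. -/
def cylinderNormal (z : ℂ) : R42 := (1 / √2) • ![-Real.sinh (z.re + z.im),
    Real.sinh (z.im - z.re), -Real.cosh (z.re + z.im), Real.cosh (z.im - z.re)]

theorem contDiff_cylinderNormal : ContDiff ℝ ∞ cylinderNormal := by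
  have hre : ContDiff ℝ ∞ Complex.re := Complex.reCLM.contDiff
  have him : ContDiff ℝ ∞ Complex.im := Complex.imCLM.contDiff
  have h1 : ContDiff ℝ ∞ fun z : ℂ => (![-Real.sinh (z.re + z.im), Real.sinh (z.im - z.re),
      -Real.cosh (z.re + z.im), Real.cosh (z.im - z.re)] : R42) := by
    refine contDiff_pi.2 fun i => ?_
    fin_cases i
    exacts [(hre.add him).sinh.neg, (him.sub hre).sinh, (hre.add him).cosh.neg,
      (him.sub hre).cosh]
  exact h1.const_smul (1 / √2 : ℝ)

/-- The derivative of the hyperbolic cylinder `ψ₀` at `z` in the direction `v`. -/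
def cylinderDiff (z v : ℂ) : R42 := (1 / √2) • ![Real.cosh (z.re + z.im) * (v.re + v.im),
    Real.cosh (z.im - z.re) * (v.im - v.re), Real.sinh (z.re + z.im) * (v.re + v.im),
    Real.sinh (z.im - z.re) * (v.im - v.re)]

theorem exists_hasFDerivAt_cylinder_zero (z : ℂ) :
    ∃ D : ℂ →L[ℝ] R42, HasFDerivAt (cylinder 0) D z ∧ ∀ v, D v = cylinderDiff z v := by
  have hre : HasFDerivAt Complex.re Complex.reCLM z := Complex.reCLM.hasFDerivAt
  have him : HasFDerivAt Complex.im Complex.imCLM z := Complex.imCLM.hasFDerivAt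
  have h1 : HasFDerivAt (fun z : ℂ => (![Real.sinh (z.re + z.im),
      Real.sinh (z.im - z.re), Real.cosh (z.re + z.im), Real.cosh (z.im - z.re)] : R42))
      (ContinuousLinearMap.pi
        ![Real.cosh (z.re + z.im) • (Complex.reCLM + Complex.imCLM),
          Real.cosh (z.im - z.re) • (Complex.imCLM - Complex.reCLM),
          Real.sinh (z.re + z.im) • (Complex.reCLM + Complex.imCLM),
          Real.sinh (z.im - z.re) • (Complex.imCLM - Complex.reCLM)]) z := by
    refine hasFDerivAt_pi.2 fun i => ?_
    fin_cases i
    exacts [(hre.add him).sinh, (him.sub hre).sinh, (hre.add him).cosh, (him.sub hre).cosh]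
  refine ⟨_, (h1.const_smul (1 / √2)).congr_of_eventuallyEq
    (Eventually.of_forall cylinder_zero), fun v => ?_⟩
  ext i
  fin_cases i <;> simp [cylinderDiff] <;> ring

theorem form42_smul_smul (r : ℝ) (u v : R42) : form42 (r • u) (r • v) = r ^ 2 * form42 u v := by
  simp only [form42, Pi.smul_apply, smul_eq_mul]; ring

theorem one_div_sqrt_two_sq : (1 / √2) ^ 2 = (1 / 2 : ℝ) := by
  rw [div_pow, Real.sq_sqrt (by norm_num)]; norm_num

theorem form42_cylinderNormal_self (z : ℂ) :
    form42 (cylinderNormal z) (cylinderNormal z) = -1 := by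
  have ha := Real.cosh_sq (z.re + z.im)
  have hb := Real.cosh_sq (z.im - z.re)
  rw [cylinderNormal, form42_smul_smul, one_div_sqrt_two_sq]
  simp only [form42, Matrix.cons_val]
  linear_combination (-1 / 2) * ha - 1 / 2 * hb

theorem form42_cylinder_cylinderNormal (z : ℂ) :
    form42 (cylinder 0 z) (cylinderNormal z) = 0 := by
  have ha := Real.cosh_sq (z.re + z.im)
  have hb := Real.cosh_sq (z.im - z.re)
  rw [cylinder_zero, cylinderNormal, form42_smul_smul, one_div_sqrt_two_sq]
  simp only [form42, Matrix.cons_val]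
  linear_combination (1 / 2) * ha - 1 / 2 * hb

theorem form42_cylinderNormal_cylinderDiff (z v : ℂ) :
    form42 (cylinderNormal z) (cylinderDiff z v) = 0 := by
  rw [cylinderNormal, cylinderDiff, form42_smul_smul]
  simp only [form42, Matrix.cons_val]
  ring

theorem form42_cylinderDiff_self (z v : ℂ) :
    form42 (cylinderDiff z v) (cylinderDiff z v) = v.re ^ 2 + v.im ^ 2 := by
  have ha := Real.cosh_sq (z.re + z.im)
  have hb := Real.cosh_sq (z.im - z.re)
  rw [cylinderDiff, form42_smul_smul, one_div_sqrt_two_sq]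
  simp only [form42, Matrix.cons_val]
  linear_combination (1 / 2 * (v.re + v.im) ^ 2) * ha + (1 / 2 * (v.im - v.re) ^ 2) * hb

theorem det_cylinder (z v : ℂ) :
    (Matrix.of ![cylinderDiff z v, cylinderDiff z (v * Complex.I), cylinder 0 z,
      cylinderNormal z]).det = v.re ^ 2 + v.im ^ 2 := by
  have ha := Real.cosh_sq (z.re + z.im)
  have hb := Real.cosh_sq (z.im - z.re)
  have h4 : (1 / √2) ^ 4 = (1 / 4 : ℝ) := by
    rw [show (4 : ℕ) = 2 * 2 from rfl, pow_mul, one_div_sqrt_two_sq]; norm_num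
  rw [cylinderDiff, cylinderDiff, cylinder_zero, cylinderNormal]
  generalize 1 / √2 = r at *
  generalize Real.cosh (z.re + z.im) = Ca, Real.sinh (z.re + z.im) = Sa,
    Real.cosh (z.im - z.re) = Cb, Real.sinh (z.im - z.re) = Sb at *
  simp [Matrix.det_succ_row_zero, Fin.sum_univ_succ, Matrix.submatrix_apply, Fin.succAbove]
  linear_combination (4 * (v.re ^ 2 + v.im ^ 2) * (Ca ^ 2 - Sa ^ 2) * (Cb ^ 2 - Sb ^ 2)) * h4
    + ((v.re ^ 2 + v.im ^ 2) * (Cb ^ 2 - Sb ^ 2)) * ha + (v.re ^ 2 + v.im ^ 2) * hb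

/-- The component `ν⁻` of the Gauss map of the cylinder `ψ₀` in a conformal parameter with
`dz(∂_x) = v`: it depends only on `a₀ + b₀ = 2 Im z`. -/
theorem gaussMap_cylinder (z v : ℂ) (hv : v.re ^ 2 + v.im ^ 2 ≠ 0) :
    (1 / √2) • ((v.re ^ 2 + v.im ^ 2)⁻¹ •
        wedge (cylinderDiff z v) (cylinderDiff z (v * Complex.I))
        + (-1 : ℝ) • wedge (cylinderNormal z) (cylinder 0 z))
      = toBiv (-1) ![Real.cosh (2 * z.im), 0, Real.sinh (2 * z.im)] := by
  have h2 : 2 * z.im = (z.re + z.im) + (z.im - z.re) := by ring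
  have hs := one_div_sqrt_two_sq
  rw [toBiv_eq, wedge_eq (cylinderDiff _ _), wedge_eq (cylinderNormal _), cylinderDiff,
    cylinderDiff, cylinder_zero, cylinderNormal, h2, Real.cosh_add (z.re + z.im),
    Real.sinh_add (z.re + z.im)]
  generalize 1 / √2 = r at *
  generalize Real.cosh (z.re + z.im) = Ca, Real.sinh (z.re + z.im) = Sa,
    Real.cosh (z.im - z.re) = Cb, Real.sinh (z.im - z.re) = Sb at *
  simp only [Matrix.cons_val, Pi.smul_apply, smul_eq_mul, Complex.mul_re, Complex.mul_im,
    Complex.I_re, Complex.I_im]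
  match_scalars <;> field_simp
  · linear_combination (2 * r * (v.re ^ 2 + v.im ^ 2) * (Ca * Cb + Sa * Sb)) * hs
  · ring
  · linear_combination (2 * r * (v.re ^ 2 + v.im ^ 2) * (Sa * Cb + Ca * Sb)) * hs
  · linear_combination (-2 * r * (v.re ^ 2 + v.im ^ 2) * (Sa * Cb + Ca * Sb)) * hs
  · ring
  · linear_combination (-2 * r * (v.re ^ 2 + v.im ^ 2) * (Ca * Cb + Sa * Sb)) * hs

end Cylinder

/-! ### The modified Gauss map -/

section Modified

variable {S : Type*} [TopologicalSpace S] [ChartedSpace ℂ S]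

theorem diffAt_cylinder_comp {z : S → ℂ} {p : S} (hz : MDifferentiableAt 𝓘(ℝ, ℂ) 𝓘(ℝ, ℂ) z p)
    (v : ℂ) : diffAt (fun q => cylinder 0 (z q)) p v = cylinderDiff (z p) (diffAt z p v) := by
  obtain ⟨D, hD, hDv⟩ := exists_hasFDerivAt_cylinder_zero (z p)
  rw [(diffAt_comp hz hD).2, hDv]

theorem isOrientedNormal_cylinder {z : S → ℂ} (hz : ContMDiff 𝓘(ℝ, ℂ) 𝓘(ℝ, ℂ) ∞ z) {ζ : S → ℂ}
    (hζ : ∀ p v, diffAt z p v = ζ p * v) (h0 : ∀ p, ζ p ≠ 0) :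
    IsOrientedNormal (fun p => cylinder 0 (z p)) fun p => cylinderNormal (z p) := by
  have hmd : ∀ p, MDifferentiableAt 𝓘(ℝ, ℂ) 𝓘(ℝ, ℂ) z p :=
    fun p => hz.contMDiffAt.mdifferentiableAt (by simp)
  refine ⟨contDiff_cylinderNormal.contMDiff.comp hz, fun p => form42_cylinderNormal_self _,
    fun p => form42_cylinder_cylinderNormal _, fun p v => ?_, fun p => ?_⟩
  · rw [diffAt_cylinder_comp (hmd p), form42_cylinderNormal_cylinderDiff]
  · rw [diffAt_cylinder_comp (hmd p), diffAt_cylinder_comp (hmd p), hζ, hζ, mul_one, det_cylinder,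
      ← Complex.normSq_add_mul_I, Complex.re_add_im]
    exact Complex.normSq_pos.2 (h0 p)

theorem gaussMap_cylinder_comp {z : S → ℂ} {p : S}
    (hz : MDifferentiableAt 𝓘(ℝ, ℂ) 𝓘(ℝ, ℂ) z p) {ζ : ℂ} (hζ : ∀ v, diffAt z p v = ζ * v)
    (h0 : ζ ≠ 0) :
    gaussMap (-1) (fun p => cylinder 0 (z p)) (fun p => cylinderNormal (z p)) p
      = toBiv (-1) ![Real.cosh (2 * (z p).im), 0, Real.sinh (2 * (z p).im)] := by
  rw [gaussMap, diffAt_cylinder_comp hz, diffAt_cylinder_comp hz, hζ, hζ, mul_one,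
    form42_cylinderDiff_self]
  refine gaussMap_cylinder _ _ ?_
  rw [← Complex.normSq_add_mul_I, Complex.re_add_im]
  exact (Complex.normSq_pos.2 h0).ne'

variable [IsManifold 𝓘(ℂ) ω S]

/-- A conformal minimal immersion `(η, h)` into `ℍ² × ℝ` without critical points of the height is
the modified Gauss map of a maximal immersion. -/
theorem IsMinimalPair.exists_isModifiedGaussMap [SimplyConnectedSpace S] {η : S → R31}
    {h : S → ℝ} (hp : IsMinimalPair η h) : ∃ ψ : S → R42, IsConformalMaximalImmersion ψ ∧
      IsModifiedGaussMap ψ fun p => pairToBiv (embH2R (η p, h p)) := by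
  obtain ⟨ψ, hψ⟩ := hp.exists_parallelSection
  obtain ⟨z, hz, hzhol, him, hz1, hzv⟩ := hp.exists_holomorphic
  have h0 : ∀ p, complexDiffAt z p 1 ≠ 0 := fun p h0 => by
    rw [hz1, mul_eq_zero] at h0
    have h1 := h0.resolve_left (by norm_num)
    have hre := congrArg Complex.re h1
    have him := congrArg Complex.im h1
    simp at hre him
    rcases hp.regular p with h2 | h2
    · exact h2 him
    · exact h2 hre
  refine ⟨ψ, hψ.isConformalMaximalImmersion hp, fun q => clifford (η q) (ψ q), 0, z,
    fun p => cylinderNormal (z p), hψ.isOrientedNormal hp, hzhol, h0, fun p => ?_,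
    isOrientedNormal_cylinder hz hzv h0, fun p => ?_⟩
  · rw [hψ.hopf_eq hp, hz1]
    simp only [Complex.ofReal_zero, mul_zero, Complex.exp_zero, mul_one]
    linear_combination (-(1 / 8) * Complex.I * (diffAt h p 1 : ℂ) ^ 2
      - (1 / 8) * Complex.I * (diffAt h p Complex.I : ℂ) ^ 2) * Complex.I_sq
  · rw [hψ.gaussMap_eq hp, gaussMap_cylinder_comp (hz.contMDiffAt.mdifferentiableAt (by simp))
      (hzv p) (h0 p), him]
    rfl

end Modified

end AdSGauss

end

theorem mainTheorem3 {S : Type*} [TopologicalSpace S] [T2Space S] [SimplyConnectedSpace S]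
    [ChartedSpace ℂ S] [IsManifold 𝓘(ℂ) ω S]
    (g : ∀ p : S, TangentSpace 𝓘(ℝ, ℂ) p → TangentSpace 𝓘(ℝ, ℂ) p → ℝ)
    (hg : AdSGauss.IsConformalMetric g)
    (φ N : S → AdSGauss.R31 × ℝ)
    (hφ_mem : ∀ p, φ p ∈ AdSGauss.H2R)
    (hφ_isom : AdSGauss.IsIsometricImmersion g AdSGauss.formH2R φ)
    (hφ_min : AdSGauss.HasZeroMeanCurvature AdSGauss.formH2R AdSGauss.tangentH2R φ)
    (hN : AdSGauss.IsUnitNormalH2R φ N)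
    (hν : ∀ p, AdSGauss.angle N p ^ 2 < 1) :
    ∃ (ψ : S → AdSGauss.R42) (G : S → AdSGauss.Biv × AdSGauss.Biv)
      (F : AdSGauss.R31 × ℝ → AdSGauss.R31 × ℝ),
      AdSGauss.IsConformalMaximalImmersion ψ ∧
      AdSGauss.IsModifiedGaussMap ψ G ∧
      AdSGauss.IsIsometryH2R F ∧
      ∀ p, AdSGauss.pairToBiv (AdSGauss.embH2R (F (φ p))) = G p := by
  obtain ⟨ψ, hψ, hG⟩ := (AdSGauss.isMinimalPair_of_minimal hg hφ_mem hφ_isom hφ_min hN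
    hν).exists_isModifiedGaussMap
  refine ⟨ψ, _, id, hψ, hG, ⟨contDiff_id, Set.bijOn_id _, fun q _ v _ w _ => ?_⟩, fun p => rfl⟩
  rw [fderiv_id]
  rfl
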